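/- Let $k$ be a field, let $Q=(Q_0,Q_1)$ be a finite acyclic quiver and let $n\ge 1$. Write $s(a)$ and $t(a)$ for the source and target of an arrow $a$, and multiply paths like maps: $pq$ means first $q$, then $p$. Let $A=kQ$ be the path algebra, $DA=\operatorname{Hom}_k(A,k)$, let $U=\operatorname{Ext}^1_A(DA,A)$, an $(A,A)$-bimodule, and let $$B=\begin{pmatrix}A&0&\cdots&0\\0&A&\cdots&0\\\vdots&\vdots&\ddots&\vdots\\0&0&\cdots&A\end{pmatrix}\oplus\begin{pmatrix}0&A&\cdots&0\\\vdots&\vdots&\ddots&\vdots\\0&0&\cdots&A\\U&0&\cdots&0\end{pmatrix}$$ be the trivial extension algebra of the first summand by the second, where the matrices have size $n\times n$ (for $n=1$, $B=A\oplus U$). Let $\widehat Q$ be the quiver with vertex set $Q_0\times\{1,\dots,n\}$ and the following arrows: (i) $a^l\colon(i,l)\to(j,l)$ for each $a\colon i\to j$ in $Q_1$ and $1\le l\le n$; (ii) $v_i^l\colon(i,l+1)\to(i,l)$ for each $i\in Q_0$ and $1\le l<n$; (iii) $a^\ast\colon(j,1)\to(i,n)$ for each $a\colon i\to j$ in $Q_1$.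 Let $I$ be the two-sided ideal of $k\widehat Q$ generated by the following relations: (i) $a^lv_i^l=v_j^la^{l+1}$ for each $a\colon i\to j$ in $Q_1$ and $1\le l<n$; (ii) $\sum_{s(a)=i}a^\ast a^1=\sum_{t(a)=i}a^na^\ast$ for each $i\in Q_0$; (iii) if $n\ge2$: $v_i^{l-1}v_i^l=0$ for each $i\in Q_0$ and $1<l<n$, and $a^\ast v_j^1=0$ and $v_i^{n-1}a^\ast=0$ for each $a\colon i\to j$ in $Q_1$; if $n=1$: $a^\ast p\,c^\ast=0$ for all $a,c\in Q_1$ and every path $p$ of $Q$, possibly of length zero, from $s(c)$ to $t(a)$. Then $B$ is presented by the quiver $\widehat Q$ with these relations: the ideal $I$ is admissible (it is contained in the square of the ideal generated by the arrows and contains some power of that ideal), and there is an isomorphism of $k$-algebras $k\widehat Q/I\cong B$. -/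

import Mathlib

open CategoryTheory

universe u v w t

/-! ## Path algebras -/

/-- All paths of a quiver, with their source and target. -/
abbrev AllPaths (V : Type v) [Quiver.{w} V] : Type (max v w) :=
  Σ i j : V, Quiver.Path i j

/-- The path algebra `kQ`, with the paths of the quiver as a `k`-basis.
Products are read like composites of functions: `p * q` is the path "first `q`, then `p`"
if `q` ends where `p` starts, and `0` otherwise. -/
def PathAlgebra (k : Type u) (V : Type v) [Field k] [Quiver.{w} V] : Type (max u v w) :=
  AllPaths.{v, w} V →₀ k

namespace PathAlgebra

section

variable (k : Type u) {V : Type v} [Field k] [Quiver.{w} V]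

noncomputable instance : AddCommGroup (PathAlgebra.{u, v, w} k V) :=
  inferInstanceAs (AddCommGroup (AllPaths.{v, w} V →₀ k))

noncomputable instance : Module k (PathAlgebra.{u, v, w} k V) :=
  inferInstanceAs (Module k (AllPaths.{v, w} V →₀ k))

/-- The basis element of the path algebra given by a path. -/
noncomputable def ofPath {i j : V} (p : Quiver.Path i j) : PathAlgebra.{u, v, w} k V :=
  Finsupp.single (⟨i, j, p⟩ : AllPaths.{v, w} V) (1 : k)

/-- The idempotent (path of length zero) at a vertex. -/
noncomputable def idem (i : V) : PathAlgebra.{u, v, w} k V := ofPath k (Quiver.Path.nil : Quiver.Path i i)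

/-- The basis element of the path algebra given by an arrow. -/
noncomputable def arrow {i j : V} (a : i ⟶ j) : PathAlgebra.{u, v, w} k V := ofPath k a.toPath

open Classical in
/-- The product of two paths: first `q`, then `p`. -/
noncomputable def pathMul (p q : AllPaths.{v, w} V) : PathAlgebra.{u, v, w} k V :=
  if h : p.1 = q.2.1 then ofPath k (q.2.2.comp (p.2.2.cast h rfl)) else 0

/-- The product of the path algebra, the bilinear extension of the product of paths. -/
noncomputable def mulMap : PathAlgebra.{u, v, w} k V →ₗ[k] PathAlgebra.{u, v, w} k V →ₗ[k]
    PathAlgebra.{u, v, w} k V :=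
  Finsupp.linearCombination k fun p : AllPaths.{v, w} V =>
    (Finsupp.linearCombination k fun q : AllPaths.{v, w} V => pathMul k p q :
      (AllPaths.{v, w} V →₀ k) →ₗ[k] PathAlgebra.{u, v, w} k V)

noncomputable instance : Mul (PathAlgebra.{u, v, w} k V) := ⟨fun x y => mulMap k x y⟩

theorem mul_def (x y : PathAlgebra.{u, v, w} k V) : x * y = mulMap k x y := rfl

theorem mulMap_ofPath {i j i' j' : V} (p : Quiver.Path i j) (q : Quiver.Path i' j') :
    mulMap k (ofPath k p) (ofPath k q) = pathMul k ⟨i, j, p⟩ ⟨i', j', q⟩ := by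
  unfold mulMap ofPath
  erw [Finsupp.linearCombination_single, one_smul, Finsupp.linearCombination_single, one_smul]

/-- The product of two composable paths. -/
theorem ofPath_mul_ofPath {i j l : V} (p : Quiver.Path j l) (q : Quiver.Path i j) :
    ofPath k p * ofPath k q = ofPath k (q.comp p) := by
  rw [mul_def, mulMap_ofPath]
  simp [pathMul]

/-- The product of two paths that are not composable. -/
theorem ofPath_mul_ofPath_of_ne {i j i' j' : V} (p : Quiver.Path i j) (q : Quiver.Path i' j')
    (h : i ≠ j') : ofPath k p * ofPath k q = 0 := by
  rw [mul_def, mulMap_ofPath]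
  simp [pathMul, h]

variable {k} in
theorem linearMap_ext {M : Type t} [AddCommGroup M] [Module k M]
    {f g : PathAlgebra.{u, v, w} k V →ₗ[k] M}
    (h : ∀ {i j : V} (p : Quiver.Path i j), f (ofPath k p) = g (ofPath k p)) : f = g := by
  refine Finsupp.lhom_ext' (M := k) fun ⟨i, j, p⟩ => LinearMap.ext_ring ?_
  exact h p

theorem mul_ofPath_assoc {i₁ j₁ i₂ j₂ i₃ j₃ : V} (p : Quiver.Path i₁ j₁) (q : Quiver.Path i₂ j₂)
    (r : Quiver.Path i₃ j₃) :
    ofPath k p * ofPath k q * ofPath k r = ofPath k p * (ofPath k q * ofPath k r) := by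
  have hz : ∀ x : PathAlgebra.{u, v, w} k V, x * 0 = 0 := fun x => map_zero (mulMap k x)
  have zh : ∀ x : PathAlgebra.{u, v, w} k V, 0 * x = 0 := fun x => by
    rw [mul_def, map_zero, LinearMap.zero_apply]
  by_cases h : i₁ = j₂
  · subst h
    by_cases h' : i₂ = j₃
    · subst h'
      simp only [ofPath_mul_ofPath, Quiver.Path.comp_assoc]
    · rw [ofPath_mul_ofPath, ofPath_mul_ofPath_of_ne _ _ _ h',
        ofPath_mul_ofPath_of_ne _ _ _ h', hz]
  · rw [ofPath_mul_ofPath_of_ne _ _ _ h, zh]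
    by_cases h' : i₂ = j₃
    · subst h'
      rw [ofPath_mul_ofPath, ofPath_mul_ofPath_of_ne _ _ _ h]
    · rw [ofPath_mul_ofPath_of_ne _ _ _ h', hz]

theorem mulMap_assoc (x y z : PathAlgebra.{u, v, w} k V) :
    mulMap k (mulMap k x y) z = mulMap k x (mulMap k y z) := by
  let F : PathAlgebra.{u, v, w} k V →ₗ[k] PathAlgebra.{u, v, w} k V →ₗ[k]
      PathAlgebra.{u, v, w} k V →ₗ[k] PathAlgebra.{u, v, w} k V :=
    (LinearMap.llcomp k _ _ _ (mulMap k)).comp (mulMap k)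
  let G : PathAlgebra.{u, v, w} k V →ₗ[k] PathAlgebra.{u, v, w} k V →ₗ[k]
      PathAlgebra.{u, v, w} k V →ₗ[k] PathAlgebra.{u, v, w} k V :=
    ((LinearMap.llcomp k _ _ _).flip (mulMap k)).comp
      ((LinearMap.llcomp k _ _ _).comp (mulMap k))
  have hFG : F = G := by
    apply linearMap_ext; intro _ _ p
    apply linearMap_ext; intro _ _ q
    apply linearMap_ext; intro _ _ r
    exact mul_ofPath_assoc k p q r
  exact congrArg (fun H => H x y z) hFG

noncomputable instance [Fintype V] : One (PathAlgebra.{u, v, w} k V) := ⟨∑ i : V, idem k i⟩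

/-- The unit of the path algebra is the sum of the vertex idempotents. -/
theorem one_def [Fintype V] : (1 : PathAlgebra.{u, v, w} k V) = ∑ i : V, idem k i := rfl

theorem mulMap_one_left [Fintype V] (x : PathAlgebra.{u, v, w} k V) : mulMap k 1 x = x := by
  have h : mulMap k (1 : PathAlgebra.{u, v, w} k V) = LinearMap.id := by
    apply linearMap_ext; intro i j p
    rw [one_def, map_sum, LinearMap.sum_apply, Finset.sum_eq_single j]
    · exact ofPath_mul_ofPath k Quiver.Path.nil p
    · intro l _ hl
      exact ofPath_mul_ofPath_of_ne k _ p hl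
    · simp
  rw [h, LinearMap.id_apply]

theorem mulMap_one_right [Fintype V] (x : PathAlgebra.{u, v, w} k V) : mulMap k x 1 = x := by
  have h : (mulMap k).flip (1 : PathAlgebra.{u, v, w} k V) = LinearMap.id := by
    apply linearMap_ext; intro i j p
    rw [one_def, LinearMap.flip_apply, map_sum, Finset.sum_eq_single i]
    · exact (ofPath_mul_ofPath k p Quiver.Path.nil).trans (by rw [Quiver.Path.nil_comp]; rfl)
    · intro l _ hl
      exact ofPath_mul_ofPath_of_ne k p _ (Ne.symm hl)
    · simp
  exact congrArg (fun H => H x) h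

noncomputable instance [Fintype V] : Ring (PathAlgebra.{u, v, w} k V) where
  __ := (inferInstance : AddCommGroup (PathAlgebra.{u, v, w} k V))
  mul := fun x y => mulMap k x y
  one := ∑ i : V, idem k i
  left_distrib x y z := map_add (mulMap k x) y z
  right_distrib x y z := by
    change mulMap k (x + y) z = mulMap k x z + mulMap k y z
    rw [map_add, LinearMap.add_apply]
  zero_mul x := by
    change mulMap k 0 x = 0
    rw [map_zero, LinearMap.zero_apply]
  mul_zero x := map_zero (mulMap k x)
  mul_assoc x y z := mulMap_assoc k x y z
  one_mul x := mulMap_one_left k x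
  mul_one x := mulMap_one_right k x

noncomputable instance [Fintype V] : Algebra k (PathAlgebra.{u, v, w} k V) :=
  Algebra.ofModule
    (fun r x y => by
      change mulMap k (r • x) y = r • mulMap k x y
      rw [map_smul, LinearMap.smul_apply])
    (fun r x y => map_smul (mulMap k x) r y)

variable (V) in
/-- The `r`-th power of the ideal generated by the arrows: the span of the paths of length at
least `r`. -/
noncomputable def lengthGE (r : ℕ) : Submodule k (PathAlgebra.{u, v, w} k V) :=
  Submodule.span k {x | ∃ (i j : V) (p : Quiver.Path i j), r ≤ p.length ∧ x = ofPath k p}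

variable {k} in
/-- A two-sided ideal of a path algebra is admissible if it lies between the square and some
power of the ideal generated by the arrows. -/
def IsAdmissible [Fintype V] (I : TwoSidedIdeal (PathAlgebra.{u, v, w} k V)) : Prop :=
  (∀ x ∈ I, x ∈ lengthGE k V 2) ∧ ∃ N : ℕ, 2 ≤ N ∧ ∀ x ∈ lengthGE k V N, x ∈ I

end

end PathAlgebra

/-! ## The bimodule `Ext_A^d(DA, A)` -/

section ExtBimodule

open MulOpposite CategoryTheory.Abelian

variable (k : Type u) (A : Type (max u v)) [Field k] [Ring A] [Algebra k A]

/-- The `k`-dual `DA = Hom_k(A, k)`. -/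
abbrev DualModule : Type (max u v) := A →ₗ[k] k

/-- The right `A`-module structure of `DA`: `(f · a)(x) = f (a x)`. -/
noncomputable instance : Module Aᵐᵒᵖ (DualModule.{u, v} k A) where
  smul a f := f.comp (LinearMap.mulLeft k a.unop)
  one_smul f := LinearMap.ext fun x => congrArg f (one_mul x)
  mul_smul a b f := LinearMap.ext fun x => congrArg f (mul_assoc b.unop a.unop x)
  smul_zero _ := rfl
  smul_add _ _ _ := rfl
  add_smul a b f := LinearMap.ext fun x =>
    (congrArg f (add_mul a.unop b.unop x)).trans (map_add f _ _)
  zero_smul f := LinearMap.ext fun x => (congrArg f (zero_mul x)).trans (map_zero f)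

/-- `DA` as a right `A`-module (right `A`-modules are modules over the opposite ring). -/
noncomputable abbrev rightDual : ModuleCat.{max u v} Aᵐᵒᵖ :=
  ModuleCat.of Aᵐᵒᵖ (DualModule.{u, v} k A)

/-- The left action `(a · f)(x) = f (x a)` of `a` on `DA`, as an endomorphism of the right
module `DA`. -/
noncomputable def dualLeft {A : Type (max u v)} [Ring A] [Algebra k A] (a : A) :
    rightDual.{u, v} k A ⟶ rightDual.{u, v} k A :=
  ModuleCat.ofHom
    { toFun := fun f : DualModule.{u, v} k A => f.comp (LinearMap.mulRight k a)
      map_add' := fun _ _ => rfl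
      map_smul' := fun b f => LinearMap.ext fun x => congrArg f (mul_assoc b.unop x a).symm }

/-- `A` as a right module over itself. -/
abbrev rightRegular (A : Type t) [Ring A] : ModuleCat.{t} Aᵐᵒᵖ := ModuleCat.of Aᵐᵒᵖ A

/-- Left multiplication by `a` on `A`, as an endomorphism of the right module `A`. -/
noncomputable def regularLeft {A : Type t} [Ring A] (a : A) : rightRegular A ⟶ rightRegular A :=
  ModuleCat.ofHom
    { toFun := fun x : A => a * x
      map_add' := fun x y => mul_add a x y
      map_smul' := fun b x => (mul_assoc a x b.unop).symm }

section

variable {A : Type t} [Ring A]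

theorem regularLeft_one : regularLeft (1 : A) = 𝟙 _ :=
  ModuleCat.hom_ext (LinearMap.ext fun x : A => one_mul x)

theorem regularLeft_mul (a b : A) : regularLeft (a * b) = regularLeft b ≫ regularLeft a :=
  ModuleCat.hom_ext (LinearMap.ext fun x : A => mul_assoc a b x)

theorem regularLeft_add (a b : A) : regularLeft (a + b) = regularLeft a + regularLeft b :=
  ModuleCat.hom_ext (LinearMap.ext fun x : A => add_mul a b x)

theorem regularLeft_zero : regularLeft (0 : A) = 0 :=
  ModuleCat.hom_ext (LinearMap.ext fun x : A => zero_mul x)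

end

section

variable {k A}

theorem dualLeft_one : dualLeft.{u, v} k (1 : A) = 𝟙 _ :=
  ModuleCat.hom_ext (LinearMap.ext fun f : DualModule.{u, v} k A => LinearMap.ext fun x : A =>
    congrArg f (mul_one x))

theorem dualLeft_mul (a b : A) :
    dualLeft.{u, v} k (a * b) = dualLeft.{u, v} k b ≫ dualLeft.{u, v} k a :=
  ModuleCat.hom_ext (LinearMap.ext fun f : DualModule.{u, v} k A => LinearMap.ext fun x : A =>
    congrArg f (mul_assoc x a b).symm)

theorem dualLeft_add (a b : A) :
    dualLeft.{u, v} k (a + b) = dualLeft.{u, v} k a + dualLeft.{u, v} k b :=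
  ModuleCat.hom_ext (LinearMap.ext fun f : DualModule.{u, v} k A => LinearMap.ext fun x : A =>
    (congrArg f (mul_add x a b)).trans
      (map_add f _ _))

theorem dualLeft_zero : dualLeft.{u, v} k (0 : A) = 0 :=
  ModuleCat.hom_ext (LinearMap.ext fun f : DualModule.{u, v} k A => LinearMap.ext fun x : A =>
    (congrArg f (mul_zero x)).trans
      (map_zero f))

end

/-- `Ext_A^d(DA, A)`, formed in the category of right `A`-modules. -/
abbrev ExtDual (d : ℕ) : Type (max u v) :=
  Ext (rightDual.{u, v} k A) (rightRegular A) d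

namespace ExtDual

variable {k A} {d : ℕ}

/-- The left `A`-module structure, induced by the left action of `A` on the second argument. -/
noncomputable instance : Module A (ExtDual.{u, v} k A d) where
  smul a x := Ext.comp x
    (Ext.mk₀ (regularLeft a)) (add_zero d)
  one_smul x := by
    change Ext.comp _ (Ext.mk₀ (regularLeft (1 : A))) (add_zero d) = _
    rw [regularLeft_one, Ext.comp_mk₀_id]
  mul_smul a b x := by
    change Ext.comp _ (Ext.mk₀ (regularLeft (a * b))) (add_zero d) =
      Ext.comp (Ext.comp _ (Ext.mk₀ (regularLeft b)) (add_zero d)) (Ext.mk₀ (regularLeft a))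
        (add_zero d)
    rw [regularLeft_mul, Ext.comp_assoc_of_third_deg_zero, Ext.mk₀_comp_mk₀]
  smul_zero a := Ext.zero_comp (X := rightDual.{u, v} k A) (n := d) _ _ (add_zero d)
  smul_add _ _ _ := Ext.add_comp _ _ _ _
  add_smul a b x := by
    change Ext.comp _ (Ext.mk₀ (regularLeft (a + b))) (add_zero d) =
      Ext.comp _ (Ext.mk₀ (regularLeft a)) (add_zero d) +
        Ext.comp _ (Ext.mk₀ (regularLeft b)) (add_zero d)
    rw [regularLeft_add, Ext.mk₀_add, Ext.comp_add]
  zero_smul x := by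
    change Ext.comp _ (Ext.mk₀ (regularLeft (0 : A))) (add_zero d) = 0
    rw [regularLeft_zero, Ext.mk₀_zero, Ext.comp_zero]

/-- The right `A`-module structure, induced by the left action of `A` on the first argument. -/
noncomputable instance : Module Aᵐᵒᵖ (ExtDual.{u, v} k A d) where
  smul a x := Ext.comp (Ext.mk₀ (dualLeft.{u, v} k a.unop))
    x (zero_add d)
  one_smul x := by
    change Ext.comp (Ext.mk₀ (dualLeft.{u, v} k (1 : A))) _ (zero_add d) = _
    rw [dualLeft_one, Ext.mk₀_id_comp]
  mul_smul a b x := by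
    change Ext.comp (Ext.mk₀ (dualLeft.{u, v} k (b.unop * a.unop))) _ (zero_add d) =
      Ext.comp (Ext.mk₀ (dualLeft.{u, v} k a.unop))
        (Ext.comp (Ext.mk₀ (dualLeft.{u, v} k b.unop)) _ (zero_add d)) (zero_add d)
    rw [dualLeft_mul, Ext.mk₀_comp_mk₀_assoc]
  smul_zero _ := Ext.comp_zero _ _ _ _ (zero_add d)
  smul_add _ _ _ := Ext.comp_add _ _ _ _
  add_smul a b x := by
    change Ext.comp (Ext.mk₀ (dualLeft.{u, v} k (a.unop + b.unop))) _ (zero_add d) =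
      Ext.comp (Ext.mk₀ (dualLeft.{u, v} k a.unop)) _ (zero_add d) +
        Ext.comp (Ext.mk₀ (dualLeft.{u, v} k b.unop)) _ (zero_add d)
    rw [dualLeft_add, Ext.mk₀_add, Ext.add_comp]
  zero_smul x := by
    change Ext.comp (Ext.mk₀ (dualLeft.{u, v} k (0 : A))) _ (zero_add d) = 0
    rw [dualLeft_zero, Ext.mk₀_zero, Ext.zero_comp]

instance : SMulCommClass A Aᵐᵒᵖ (ExtDual.{u, v} k A d) where
  smul_comm a b x := by
    change Ext.comp (Ext.comp (Ext.mk₀ (dualLeft.{u, v} k b.unop)) _ (zero_add d))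
        (Ext.mk₀ (regularLeft a)) (add_zero d) =
      Ext.comp (Ext.mk₀ (dualLeft.{u, v} k b.unop))
        (Ext.comp _ (Ext.mk₀ (regularLeft a)) (add_zero d)) (zero_add d)
    rw [Ext.comp_assoc_of_third_deg_zero]

theorem comp_mk₀_eq_smul {C : Type*} [Category* C] [Abelian C] [Linear k C] [HasExt.{t} C]
    {X Y : C} (x : Ext X Y d) (r : k) (f : Y ⟶ Y) (hf : f = r • 𝟙 Y) :
    x.comp (Ext.mk₀ f) (add_zero d) = r • x := by
  rw [hf, Ext.smul_eq_comp_mk₀]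

theorem mk₀_comp_eq_smul {C : Type*} [Category* C] [Abelian C] [Linear k C] [HasExt.{t} C]
    {X Y : C} (x : Ext X Y d) (r : k) (f : X ⟶ X) (hf : f = r • 𝟙 X) :
    (Ext.mk₀ f).comp x (zero_add d) = r • x := by
  rw [hf, Ext.mk₀_smul, Ext.smul_comp, Ext.mk₀_id_comp]

theorem algebraMap_smul_left (r : k) (x : ExtDual.{u, v} k A d) :
    algebraMap k A r • x = r • x :=
  comp_mk₀_eq_smul x r (regularLeft (algebraMap k A r))
    (ModuleCat.hom_ext (LinearMap.ext fun x : A => Algebra.commutes r x))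

theorem algebraMap_smul_right (r : k) (x : ExtDual.{u, v} k A d) :
    op (algebraMap k A r) • x = r • x :=
  mk₀_comp_eq_smul x r (dualLeft.{u, v} k (algebraMap k A r))
    (ModuleCat.hom_ext (LinearMap.ext fun f : DualModule.{u, v} k A => LinearMap.ext fun x : A =>
      congrArg f (Algebra.commutes r x).symm))

instance : IsScalarTower k A (ExtDual.{u, v} k A d) where
  smul_assoc r a x := by
    rw [Algebra.smul_def, mul_smul, algebraMap_smul_left]

instance : IsScalarTower k Aᵐᵒᵖ (ExtDual.{u, v} k A d) where
  smul_assoc r a x := by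
    rw [← algebraMap_smul_right r (a • x), ← mul_smul]
    congr 1
    exact unop_injective ((Algebra.smul_def r a.unop).trans (Algebra.commutes r a.unop))

end ExtDual

end ExtBimodule

/-! ## The trivial extension algebra -/

section TrivialExtension

open MulOpposite

variable (k : Type u) (A : Type (max u v)) [Field k] [Ring A] [Algebra k A] (d m : ℕ)

/-- The product `A × ⋯ × A` of `n = m + 1` copies of `A`, that is, the `n × n` diagonal matrices
with entries in `A`. The index `0` stands for the first copy. -/
abbrev DiagonalAlgebra (A : Type t) (m : ℕ) : Type t := Fin (m + 1) → A

/-- The bimodule, over the algebra of diagonal `n × n` matrices (`n = m + 1`), of all `n × n`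
matrices whose `(l, l + 1)`-entries are in `A` for `1 ≤ l < n`, whose `(n, 1)`-entry is in
`U = Ext_A^d(DA, A)`, and whose other entries are zero. An element is recorded by its
superdiagonal and its corner entry. -/
def CornerBimodule : Type (max u v) := (Fin m → A) × ExtDual.{u, v} k A d

namespace CornerBimodule

variable {k A d m}

noncomputable instance : AddCommGroup (CornerBimodule.{u, v} k A d m) :=
  inferInstanceAs (AddCommGroup ((Fin m → A) × ExtDual.{u, v} k A d))

noncomputable instance : Module k (CornerBimodule.{u, v} k A d m) :=
  inferInstanceAs (Module k ((Fin m → A) × ExtDual.{u, v} k A d))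

/-- Multiplication by a diagonal matrix from the left multiplies row `l` by its `l`-th entry. -/
noncomputable instance : Module (DiagonalAlgebra A m) (CornerBimodule.{u, v} k A d m) where
  smul r x := (fun l => r l.castSucc * x.1 l, r (Fin.last m) • x.2)
  one_smul x := Prod.ext (funext fun l => one_mul (x.1 l)) (one_smul A x.2)
  mul_smul _ _ x := Prod.ext (funext fun l => mul_assoc _ _ (x.1 l)) (mul_smul _ _ x.2)
  smul_zero _ := Prod.ext (funext fun _ => mul_zero _) (smul_zero _)
  smul_add _ x y := Prod.ext (funext fun l => mul_add _ (x.1 l) (y.1 l)) (smul_add _ x.2 y.2)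
  add_smul _ _ x := Prod.ext (funext fun l => add_mul _ _ (x.1 l)) (add_smul _ _ x.2)
  zero_smul x := Prod.ext (funext fun l => zero_mul (x.1 l)) (zero_smul A x.2)

/-- Multiplication by a diagonal matrix from the right multiplies column `l` by its `l`-th
entry. -/
noncomputable instance : Module (DiagonalAlgebra A m)ᵐᵒᵖ (CornerBimodule.{u, v} k A d m) where
  smul r x := (fun l => x.1 l * r.unop l.succ, op (r.unop 0) • x.2)
  one_smul x := Prod.ext (funext fun l => mul_one (x.1 l)) (one_smul Aᵐᵒᵖ x.2)
  mul_smul _ _ x := Prod.ext (funext fun l => (mul_assoc (x.1 l) _ _).symm)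
    (mul_smul _ _ x.2)
  smul_zero _ := Prod.ext (funext fun _ => zero_mul _) (smul_zero _)
  smul_add _ x y := Prod.ext (funext fun l => add_mul (x.1 l) (y.1 l) _) (smul_add _ x.2 y.2)
  add_smul _ _ x := Prod.ext (funext fun l => mul_add (x.1 l) _ _)
    (add_smul _ _ x.2)
  zero_smul x := Prod.ext (funext fun l => mul_zero (x.1 l)) (zero_smul Aᵐᵒᵖ x.2)

instance : SMulCommClass (DiagonalAlgebra A m) (DiagonalAlgebra A m)ᵐᵒᵖ
    (CornerBimodule.{u, v} k A d m) where
  smul_comm r s x := Prod.ext (funext fun l => (mul_assoc _ (x.1 l) _).symm)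
    (smul_comm (r (Fin.last m)) (op (s.unop 0)) x.2)

instance : IsScalarTower k (DiagonalAlgebra A m) (CornerBimodule.{u, v} k A d m) where
  smul_assoc c r x := Prod.ext (funext fun l => smul_mul_assoc c (r l.castSucc) (x.1 l))
    (smul_assoc c (r (Fin.last m)) x.2)

instance : IsScalarTower k (DiagonalAlgebra A m)ᵐᵒᵖ (CornerBimodule.{u, v} k A d m) where
  smul_assoc c r x := Prod.ext (funext fun l => mul_smul_comm c (x.1 l) (r.unop l.succ))
    (smul_assoc c (op (r.unop 0)) x.2)

end CornerBimodule

/-- The trivial extension algebra `B` of the diagonal matrices by the above bimodule, for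
`n × n` matrices with `n = m + 1`. -/
abbrev TrivialExtensionAlgebra : Type (max u v) :=
  TrivSqZeroExt (DiagonalAlgebra A m) (CornerBimodule.{u, v} k A d m)

end TrivialExtension

/-! ## The quiver with relations -/

/-- The vertex set `Q₀ × {1, …, n}` with `n = m + 1`; the copy `l` is indexed by `l - 1`. -/
@[ext]
structure HatVertex (V : Type v) (m : ℕ) : Type v where
  vertex : V
  copy : Fin (m + 1)

/-- The vertices are the pairs of a vertex of `Q` and the number of a copy. -/
def HatVertex.equivProd (V : Type v) (m : ℕ) : HatVertex V m ≃ V × Fin (m + 1) where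
  toFun x := (x.vertex, x.copy)
  invFun x := ⟨x.1, x.2⟩

noncomputable instance (V : Type v) (m : ℕ) [Fintype V] : Fintype (HatVertex V m) :=
  Fintype.ofEquiv _ (HatVertex.equivProd V m).symm

/-- The three kinds of arrows of the quiver on `HatVertex V m`. -/
inductive HatArrow (V : Type v) [Quiver.{w} V] (m : ℕ) :
    HatVertex V m → HatVertex V m → Type (max v w)
  /-- `aˡ : (i, l) → (j, l)` for `a : i → j`. -/
  | copy {i j : V} (a : i ⟶ j) (l : Fin (m + 1)) : HatArrow V m ⟨i, l⟩ ⟨j, l⟩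
  /-- `vᵢˡ : (i, l + 1) → (i, l)` for consecutive copies. -/
  | down (i : V) (l : Fin m) : HatArrow V m ⟨i, l.succ⟩ ⟨i, l.castSucc⟩
  /-- `a* : (j, 1) → (i, n)` for `a : i → j`. -/
  | star {i j : V} (a : i ⟶ j) : HatArrow V m ⟨j, 0⟩ ⟨i, Fin.last m⟩

instance (V : Type v) [Quiver.{w} V] (m : ℕ) : Quiver.{max v w} (HatVertex V m) where
  Hom := HatArrow.{v, w} V m

section HatRelations

variable (k : Type u) {V : Type v} [Field k] [Quiver.{w} V] {m : ℕ}

/-- The arrow `aˡ` as an element of the path algebra. -/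
noncomputable def hatCopy {i j : V} (a : i ⟶ j) (l : Fin (m + 1)) :
    PathAlgebra k (HatVertex V m) :=
  PathAlgebra.arrow k (HatArrow.copy a l : (⟨i, l⟩ : HatVertex V m) ⟶ (⟨j, l⟩ : HatVertex V m))

/-- The arrow `vᵢˡ` as an element of the path algebra. -/
noncomputable def hatDown (i : V) (l : Fin m) : PathAlgebra k (HatVertex V m) :=
  PathAlgebra.arrow k (HatArrow.down i l :
    (⟨i, l.succ⟩ : HatVertex V m) ⟶ (⟨i, l.castSucc⟩ : HatVertex V m))

/-- The arrow `a*` as an element of the path algebra. -/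
noncomputable def hatStar (m : ℕ) {i j : V} (a : i ⟶ j) : PathAlgebra k (HatVertex V m) :=
  PathAlgebra.arrow k (HatArrow.star a :
    (⟨j, 0⟩ : HatVertex V m) ⟶ (⟨i, Fin.last m⟩ : HatVertex V m))

/-- The inclusion of the quiver `Q` as the `l`-th copy. -/
def hatLayer (V : Type v) [Quiver.{w} V] (l : Fin (m + 1)) : V ⥤q HatVertex V m where
  obj i := ⟨i, l⟩
  map a := HatArrow.copy a l

/-- A path of `Q` in the `l`-th copy, as an element of the path algebra. -/
noncomputable def hatPath {i j : V} (p : Quiver.Path i j) (l : Fin (m + 1)) :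
    PathAlgebra k (HatVertex V m) :=
  PathAlgebra.ofPath k ((hatLayer V l).mapPath p)

variable (V m) in
/-- The relations; `HatRelation k V m x` says that `x = 0` is one of them. -/
inductive HatRelation [Fintype V] [∀ i j : V, Fintype (i ⟶ j)] :
    PathAlgebra k (HatVertex V m) → Prop
  /-- `aˡ vᵢˡ = vⱼˡ aˡ⁺¹` for `a : i → j` and `1 ≤ l < n`. -/
  | comm {i j : V} (a : i ⟶ j) (l : Fin m) :
      HatRelation (hatCopy k a l.castSucc * hatDown k i l - hatDown k j l * hatCopy k a l.succ)
  /-- `∑ a* a¹ = ∑ aⁿ a*`, over the arrows `a` starting at `i` on the left hand side and over the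
  arrows `a` ending at `i` on the right hand side. -/
  | preprojective (i : V) :
      HatRelation ((∑ j : V, ∑ a : i ⟶ j, hatStar k m a * hatCopy k a 0) -
        ∑ j : V, ∑ a : j ⟶ i, hatCopy k a (Fin.last m) * hatStar k m a)
  /-- `vᵢˡ⁻¹ vᵢˡ = 0` for `1 < l < n`. -/
  | down_down (i : V) (l l' : Fin m) (h : (l' : ℕ) + 1 = l) :
      HatRelation (hatDown k i l' * hatDown k i l)
  /-- `a* vⱼ¹ = 0` for `a : i → j`, where `n ≥ 2`. -/
  | star_down {i j : V} (a : i ⟶ j) (l : Fin m) (h : (l : ℕ) = 0) :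
      HatRelation (hatStar k m a * hatDown k j l)
  /-- `vᵢⁿ⁻¹ a* = 0` for `a : i → j`, where `n ≥ 2`. -/
  | down_star {i j : V} (a : i ⟶ j) (l : Fin m) (h : (l : ℕ) + 1 = m) :
      HatRelation (hatDown k i l * hatStar k m a)
  /-- If `n = 1`: `a* p c* = 0` for all arrows `c : i → j` and `a : i' → j'` and every path `p`
  of `Q` (possibly of length zero) from `i` to `j'`. -/
  | star_path_star (hm : m = 0) {i j i' j' : V} (a : i' ⟶ j') (p : Quiver.Path i j') (c : i ⟶ j) :
      HatRelation (hatStar k m a * hatPath k p 0 * hatStar k m c)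

variable (V m) in
/-- The two-sided ideal generated by the relations. -/
noncomputable def hatIdeal [Fintype V] [∀ i j : V, Fintype (i ⟶ j)] :
    TwoSidedIdeal (PathAlgebra k (HatVertex V m)) :=
  TwoSidedIdeal.span {x | HatRelation k V m x}

end HatRelations

/-! The algebra `B` is assembled from diagonal copies of `A`, superdiagonal copies of `A`, and the
corner `U = Ext¹(DA, A)`. A superdiagonal copy is the bimodule `A` on one generator `v` with `x v =
v x`, which is relation (i) summed over the vertices. The real content is therefore a presentation
of `U` as a bimodule: one generator `a*` for each arrow `a : i → j`, with `eᵢ a* eⱼ = a*`, and one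
relation `∑ a* a = ∑ a a*` for each vertex.

This presentation is read off from the standard resolution of right modules `0 → ⨁ₐ D(eⱼA) ⊗ eᵢA →
⨁ᵢ D(eᵢA) ⊗ eᵢA → DA → 0`. Acyclicity makes `A` finite dimensional, so `D(eⱼA) ⊗ eᵢA` can be
replaced by `Hom_k(eⱼA, eᵢA)`. Both terms then consist of linear endomorphisms of `A`, the
differential is a sum of commutators with the arrows, and the augmentation is a trace. Exactness
follows by removing the last arrow of a path, a process that stops because path lengths are bounded.
The middle term is projective, so `U` is the cokernel of `Hom(P₀, A) → Hom(P₁, A)`. Evaluation at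
`eⱼ` of the component at `a` gives `a*`, and evaluation at `eᵢ` on `P₀` gives the relation at `i`
(`extDual_linearMap_ext`, `sum_extArrow_eq`). That no further relations are needed is the universal
property `exists_extLift`.

Sending vertices and arrows to the evident elements of `B` gives `hatMap`, which is onto and kills
the relations. The universal property of `U` and that of the trivial extension give a homomorphism
from `B` to the quotient by `I` whose composite with `hatMap` is the quotient map
(`trivialExtensionToHat_hatMap`). Hence the kernel of `hatMap` is exactly `I`. Admissibility
follows: every relation involves only products of at least two arrows, and a path with two arrows
outside the copies of `Q` has image zero, so long paths lie in `I`. -/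

namespace PathAlgebra

/-! ### Path algebras: the path basis and the vertex idempotents -/

section Basis

variable (k : Type u) {V : Type v} [Field k] [Quiver.{w} V]

variable (V) in
/-- The paths form a basis of the path algebra. -/
noncomputable def pathBasis : Module.Basis (AllPaths.{v, w} V) k (PathAlgebra.{u, v, w} k V) :=
  ⟨LinearEquiv.refl k (AllPaths.{v, w} V →₀ k)⟩

theorem pathBasis_apply (p : AllPaths.{v, w} V) : pathBasis k V p = ofPath k p.2.2 := rfl

instance [Finite (AllPaths.{v, w} V)] : Module.Finite k (PathAlgebra.{u, v, w} k V) :=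
  Module.Finite.of_basis (pathBasis k V)

@[simp]
theorem idem_mul_idem (i : V) : idem k i * idem k i = idem k i := by
  rw [idem, ofPath_mul_ofPath]; rfl

theorem idem_mul_idem_of_ne {i j : V} (h : i ≠ j) : idem k i * idem k j = 0 :=
  ofPath_mul_ofPath_of_ne k _ _ h

@[simp]
theorem idem_mul_ofPath {i j : V} (p : Quiver.Path i j) : idem k j * ofPath k p = ofPath k p := by
  rw [idem, ofPath_mul_ofPath]; rfl

theorem idem_mul_ofPath_of_ne {i j l : V} (p : Quiver.Path i j) (h : l ≠ j) :
    idem k l * ofPath k p = 0 :=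
  ofPath_mul_ofPath_of_ne k _ _ h

@[simp]
theorem ofPath_mul_idem {i j : V} (p : Quiver.Path i j) : ofPath k p * idem k i = ofPath k p := by
  rw [idem, ofPath_mul_ofPath, Quiver.Path.nil_comp]

theorem ofPath_mul_idem_of_ne {i j l : V} (p : Quiver.Path i j) (h : i ≠ l) :
    ofPath k p * idem k l = 0 :=
  ofPath_mul_ofPath_of_ne k _ _ h

@[simp]
theorem idem_mul_arrow {i j : V} (a : i ⟶ j) : idem k j * arrow k a = arrow k a :=
  idem_mul_ofPath k _

@[simp]
theorem arrow_mul_idem {i j : V} (a : i ⟶ j) : arrow k a * idem k i = arrow k a :=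
  ofPath_mul_idem k _

theorem idem_mul_arrow_of_ne {i j l : V} (a : i ⟶ j) (h : l ≠ j) : idem k l * arrow k a = 0 :=
  idem_mul_ofPath_of_ne k _ h

theorem arrow_mul_idem_of_ne {i j l : V} (a : i ⟶ j) (h : i ≠ l) : arrow k a * idem k l = 0 :=
  ofPath_mul_idem_of_ne k _ h

theorem ofPath_cons {i j l : V} (p : Quiver.Path i j) (a : j ⟶ l) :
    ofPath k (p.cons a) = arrow k a * ofPath k p := by
  rw [arrow, ofPath_mul_ofPath]; rfl

theorem sum_idem_mul [Fintype V] (x : PathAlgebra.{u, v, w} k V) : ∑ i, idem k i * x = x := by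
  rw [← Finset.sum_mul, ← one_def, one_mul]

end Basis

/-! ### The universal property of the path algebra -/

section Lift

variable {k : Type u} {V : Type v} [Field k] [Quiver.{w} V] {B : Type t} [Ring B] [Algebra k B]

/-- The value of a path, given values of the vertices and arrows. -/
def evalPath (e : V → B) (x : ∀ {i j : V}, (i ⟶ j) → B) {i : V} : ∀ {j : V}, Quiver.Path i j → B
  | _, .nil => e i
  | _, .cons p a => x a * evalPath e x p

variable (e : V → B) (x : ∀ {i j : V}, (i ⟶ j) → B)
  (idem_e : ∀ i, e i * e i = e i) (orth_e : ∀ i j, i ≠ j → e i * e j = 0)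
  (left_x : ∀ {i j : V} (a : i ⟶ j), e j * x a = x a)

include idem_e in
theorem evalPath_mul_idem {i j : V}
    (p : Quiver.Path i j) : evalPath e x p * e i = evalPath e x p := by
  induction p with
  | nil => exact idem_e i
  | cons p a ih => rw [evalPath, mul_assoc, ih]

include idem_e in
theorem idem_mul_evalPath (left_x : ∀ {i j : V} (a : i ⟶ j), e j * x a = x a) {i j : V}
    (p : Quiver.Path i j) : e j * evalPath e x p = evalPath e x p := by
  cases p with
  | nil => exact idem_e i
  | cons p a => rw [evalPath, ← mul_assoc, left_x]

include idem_e in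
theorem evalPath_comp (left_x : ∀ {i j : V} (a : i ⟶ j), e j * x a = x a) {i j l : V}
    (q : Quiver.Path i j) (p : Quiver.Path j l) :
    evalPath e x (q.comp p) = evalPath e x p * evalPath e x q := by
  induction p with
  | nil => exact (idem_mul_evalPath e x idem_e left_x q).symm
  | cons p a ih => rw [Quiver.Path.comp_cons, evalPath, ih, evalPath, mul_assoc]

variable [Fintype V] (sum_e : ∑ i, e i = 1)

/-- The algebra homomorphism from the path algebra given by values of the vertices and arrows. -/
noncomputable def lift : PathAlgebra.{u, v, w} k V →ₐ[k] B :=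
  AlgHom.ofLinearMap ((pathBasis k V).constr k fun p => evalPath e x p.2.2)
    (by
      rw [one_def, map_sum, ← sum_e]
      exact Finset.sum_congr rfl fun i _ => (pathBasis k V).constr_basis k _ ⟨i, i, .nil⟩)
    (by
      set F := (pathBasis k V).constr k fun p => evalPath e x p.2.2 with hF
      have hFp : ∀ {i j : V} (p : Quiver.Path i j), F (ofPath k p) = evalPath e x p :=
        fun {i j} p => (pathBasis k V).constr_basis k _ ⟨i, j, p⟩
      intro y z
      have key : F ∘ₗ LinearMap.mul k _ y = LinearMap.mul k _ (F y) ∘ₗ F := by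
        apply linearMap_ext
        intro i j q
        have : F ∘ₗ (LinearMap.mul k _).flip (ofPath k q) =
            (LinearMap.mul k _).flip (F (ofPath k q)) ∘ₗ F := by
          apply linearMap_ext
          intro i' j' p
          simp only [LinearMap.comp_apply, LinearMap.flip_apply, LinearMap.mul_apply', hFp]
          by_cases h : i' = j
          · subst h
            rw [ofPath_mul_ofPath, hFp, evalPath_comp e x idem_e left_x]
          -- The values of two non-composable paths are separated by orthogonal idempotents.
          · rw [ofPath_mul_ofPath_of_ne k _ _ h, map_zero,
              ← evalPath_mul_idem e x idem_e, ← idem_mul_evalPath e x idem_e left_x q,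
              mul_assoc, ← mul_assoc (e i'), orth_e _ _ h, zero_mul, mul_zero]
        exact LinearMap.congr_fun this y
      exact LinearMap.congr_fun key z)

theorem lift_ofPath {i j : V} (p : Quiver.Path i j) :
    lift (k := k) e x idem_e orth_e left_x sum_e (ofPath k p) = evalPath e x p :=
  (pathBasis k V).constr_basis k _ ⟨i, j, p⟩

theorem lift_idem (i : V) :
    lift (k := k) e x idem_e orth_e left_x sum_e (idem k i) = e i :=
  lift_ofPath e x idem_e orth_e left_x sum_e _

theorem lift_arrow {i j : V} (a : i ⟶ j) (right_x : x a * e i = x a) :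
    lift (k := k) e x idem_e orth_e left_x sum_e (arrow k a) = x a :=
  (lift_ofPath e x idem_e orth_e left_x sum_e _).trans right_x

theorem algHom_ext {f g : PathAlgebra.{u, v, w} k V →ₐ[k] B}
    (h : ∀ i, f (idem k i) = g (idem k i))
    (h' : ∀ {i j : V} (a : i ⟶ j), f (arrow k a) = g (arrow k a)) : f = g := by
  apply AlgHom.toLinearMap_injective
  apply linearMap_ext
  intro i j p
  induction p with
  | nil => exact h i
  | cons p a ih =>
    simp only [AlgHom.toLinearMap_apply] at ih ⊢
    rw [ofPath_cons, map_mul, map_mul, ih, h']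

end Lift

/-! ### The filtration of the path algebra by path length -/

section Length

variable {k : Type u} {V : Type v} [Field k] [Quiver.{w} V]

theorem ofPath_mem_lengthGE {r : ℕ} {i j : V} (p : Quiver.Path i j) (h : r ≤ p.length) :
    ofPath k p ∈ lengthGE k V r :=
  Submodule.subset_span ⟨i, j, p, h, rfl⟩

theorem mem_lengthGE_zero (x : PathAlgebra.{u, v, w} k V) : x ∈ lengthGE k V 0 := by
  rw [← (pathBasis k V).linearCombination_repr x, Finsupp.linearCombination_apply]
  exact Submodule.sum_mem _ fun p _ =>
    Submodule.smul_mem _ _ (ofPath_mem_lengthGE p.2.2 (Nat.zero_le _))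

theorem lengthGE_eq_bot {N : ℕ} (h : ∀ (i j : V) (p : Quiver.Path i j), p.length < N) :
    lengthGE k V N = ⊥ := by
  rw [lengthGE, Submodule.span_eq_bot]
  rintro _ ⟨i, j, p, hp, -⟩
  exact absurd (h i j p) (by omega)

theorem mul_mem_lengthGE [Fintype V] {r s : ℕ} {x y : PathAlgebra.{u, v, w} k V}
    (hx : x ∈ lengthGE k V r) (hy : y ∈ lengthGE k V s) : x * y ∈ lengthGE k V (r + s) := by
  induction hx using Submodule.span_induction with
  | zero => rw [zero_mul]; exact Submodule.zero_mem _
  | add x x' _ _ h h' => rw [add_mul]; exact Submodule.add_mem _ h h'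
  | smul c x _ h => rw [smul_mul_assoc]; exact Submodule.smul_mem _ _ h
  | mem x hx =>
    obtain ⟨i, j, p, hp, rfl⟩ := hx
    induction hy using Submodule.span_induction with
    | zero => rw [mul_zero]; exact Submodule.zero_mem _
    | add x x' _ _ h h' => rw [mul_add]; exact Submodule.add_mem _ h h'
    | smul c x _ h => rw [mul_smul_comm]; exact Submodule.smul_mem _ _ h
    | mem y hy =>
      obtain ⟨i', j', q, hq, rfl⟩ := hy
      by_cases h : i = j'
      · subst h
        rw [ofPath_mul_ofPath]
        exact ofPath_mem_lengthGE _ (by rw [Quiver.Path.length_comp]; omega)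
      · rw [ofPath_mul_ofPath_of_ne k _ _ h]
        exact Submodule.zero_mem _

theorem arrow_mem_lengthGE {i j : V} (a : i ⟶ j) : arrow k a ∈ lengthGE k V 1 :=
  ofPath_mem_lengthGE _ le_rfl

theorem arrow_mul_mem_lengthGE [Fintype V] {i j : V} (a : i ⟶ j) {r : ℕ}
    {x : PathAlgebra.{u, v, w} k V} (hx : x ∈ lengthGE k V r) :
    arrow k a * x ∈ lengthGE k V (r + 1) := by
  rw [add_comm]
  exact mul_mem_lengthGE (arrow_mem_lengthGE a) hx

theorem exists_length_lt [Finite (AllPaths.{v, w} V)] :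
    ∃ N : ℕ, ∀ (i j : V) (p : Quiver.Path i j), p.length < N := by
  obtain ⟨N, hN⟩ := (Set.finite_range fun p : AllPaths.{v, w} V => p.2.2.length).bddAbove
  exact ⟨N + 1, fun i j p => Nat.lt_succ_of_le (hN ⟨⟨i, j, p⟩, rfl⟩)⟩

end Length

end PathAlgebra

/-! ### Finiteness of the set of paths of a finite acyclic quiver -/

section Acyclic

variable {V : Type v} [Quiver.{w} V] (acyclic : ∀ (i : V) (p : Quiver.Path i i), p.length = 0)

include acyclic

/-- If the endpoint of the last arrow had been visited before, the part of the path from there on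
would be a closed path of positive length. -/
theorem Quiver.Path.vertices_nodup_of_acyclic {i j : V} (p : Quiver.Path i j) :
    p.vertices.Nodup := by
  induction p with
  | nil => simp
  | cons p a ih =>
    rw [Quiver.Path.vertices_cons, List.nodup_concat]
    refine ⟨fun hmem => ?_, ih⟩
    obtain ⟨-, q, -⟩ := Quiver.Path.exists_eq_comp_of_mem_vertices p hmem
    have := acyclic _ (q.cons a)
    simp at this

theorem Quiver.Path.length_lt_card_of_acyclic [Fintype V] {i j : V} (p : Quiver.Path i j) :
    p.length < Fintype.card V := by
  have := (p.vertices_nodup_of_acyclic acyclic).length_le_card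
  rw [Quiver.Path.vertices_length] at this
  omega

omit acyclic in
theorem AllPaths.finite_length_le [Finite V] [∀ i j : V, Finite (i ⟶ j)] (n : ℕ) :
    {p : AllPaths.{v, w} V | p.2.2.length ≤ n}.Finite := by
  induction n with
  | zero =>
    refine (Set.finite_range fun i : V => (⟨i, i, .nil⟩ : AllPaths.{v, w} V)).subset ?_
    rintro ⟨i, j, p⟩ hp
    cases p with
    | nil => exact ⟨i, rfl⟩
    | cons p a => simp at hp
  | succ n ih =>
    refine ((Set.finite_range fun i : V => (⟨i, i, .nil⟩ : AllPaths.{v, w} V)).union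
      (ih.biUnion fun q _ => Set.finite_range fun a : Σ l : V, q.2.1 ⟶ l =>
        (⟨q.1, a.1, q.2.2.cons a.2⟩ : AllPaths.{v, w} V))).subset ?_
    rintro ⟨i, j, p⟩ hp
    cases p with
    | nil => exact .inl ⟨i, rfl⟩
    | @cons l _ p a =>
      refine .inr (Set.mem_biUnion (x := ⟨i, l, p⟩) ?_ ⟨⟨j, a⟩, rfl⟩)
      simpa using hp

theorem AllPaths.finite_of_acyclic [Finite V] [∀ i j : V, Finite (i ⟶ j)] :
    Finite (AllPaths.{v, w} V) := by
  have := Fintype.ofFinite V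
  refine Set.finite_univ_iff.mp ((AllPaths.finite_length_le (Fintype.card V)).subset ?_)
  rintro ⟨i, j, p⟩ -
  exact (p.length_lt_card_of_acyclic acyclic).le

end Acyclic

/-- The arrows of a quiver, with their source and target. -/
abbrev AllArrows (V : Type v) [Quiver.{w} V] : Type (max v w) :=
  Σ i j : V, i ⟶ j

namespace PathAlgebra

/-! ### Removing the last arrow of a path -/

section Peel

variable (k : Type u) {V : Type v} [Field k] [Quiver.{w} V]

open Classical in
/-- Remove the last arrow of a path if it is `a`; the result is zero for all other paths. -/
noncomputable def peelPath (a : AllArrows V) : AllPaths V → PathAlgebra k V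
  | ⟨_, _, .nil⟩ => 0
  | ⟨_, _, .cons p b⟩ => if (⟨_, _, b⟩ : AllArrows V) = a then ofPath k p else 0

/-- The linear extension of the removal of a last arrow `a`. -/
noncomputable def peel (a : AllArrows V) : PathAlgebra k V →ₗ[k] PathAlgebra k V :=
  (pathBasis k V).constr k (peelPath k a)

/-- The coefficient of the idempotent at a vertex. -/
noncomputable def idemCoord (i : V) : PathAlgebra k V →ₗ[k] k :=
  (pathBasis k V).coord ⟨i, i, .nil⟩

theorem peel_ofPath (a : AllArrows V) {i j : V} (p : Quiver.Path i j) :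
    peel k a (ofPath k p) = peelPath k a ⟨i, j, p⟩ :=
  (pathBasis k V).constr_basis k _ ⟨i, j, p⟩

theorem idemCoord_ofPath_cons (l : V) {i j j' : V} (p : Quiver.Path i j) (a : j ⟶ j') :
    idemCoord k l (ofPath k (p.cons a)) = 0 := by
  rw [idemCoord, ← pathBasis_apply k (⟨i, j', p.cons a⟩ : AllPaths V), Module.Basis.coord_apply,
    Module.Basis.repr_self, Finsupp.single_eq_of_ne]
  intro h
  have := congrArg (fun p : AllPaths V => p.2.2.length) h
  simp at this

theorem idemCoord_idem (i : V) : idemCoord k i (idem k i) = 1 := by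
  rw [idemCoord, idem, ← pathBasis_apply k (⟨i, i, .nil⟩ : AllPaths V), Module.Basis.coord_apply,
    Module.Basis.repr_self, Finsupp.single_eq_same]

theorem idemCoord_idem_of_ne {i j : V} (h : i ≠ j) : idemCoord k i (idem k j) = 0 := by
  rw [idemCoord, idem, ← pathBasis_apply k (⟨j, j, .nil⟩ : AllPaths V), Module.Basis.coord_apply,
    Module.Basis.repr_self, Finsupp.single_eq_of_ne]
  intro h'
  exact h (congrArg (fun p : AllPaths V => p.1) h')

theorem peel_idem (a : AllArrows V) (i : V) : peel k a (idem k i) = 0 := by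
  rw [idem, peel_ofPath]; rfl

variable [Fintype V]

/-- Left multiplication by `a` is injective on `eᵢA` and kills the other summands `eₗA`; hence the
idempotent on the right. -/
theorem peel_arrow_mul_self {i j : V} (a : i ⟶ j) (x : PathAlgebra k V) :
    peel k ⟨i, j, a⟩ (arrow k a * x) = idem k i * x := by
  have : peel k ⟨i, j, a⟩ ∘ₗ LinearMap.mulLeft k (arrow k a) = LinearMap.mulLeft k (idem k i) := by
    apply linearMap_ext
    intro i' j' p
    simp only [LinearMap.comp_apply, LinearMap.mulLeft_apply]
    by_cases h : i = j'
    · subst h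
      rw [← ofPath_cons, peel_ofPath, idem_mul_ofPath]
      exact if_pos rfl
    · rw [arrow, ofPath_mul_ofPath_of_ne k _ _ h, idem_mul_ofPath_of_ne k _ h, map_zero]
  exact LinearMap.congr_fun this x

theorem peel_arrow_mul_of_ne {a : AllArrows V} {i j : V} (b : i ⟶ j)
    (hb : (⟨i, j, b⟩ : AllArrows V) ≠ a) (x : PathAlgebra k V) :
    peel k a (arrow k b * x) = 0 := by
  have : peel k a ∘ₗ LinearMap.mulLeft k (arrow k b) = 0 := by
    apply linearMap_ext
    intro i' j' p
    simp only [LinearMap.comp_apply, LinearMap.mulLeft_apply]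
    by_cases h : i = j'
    · subst h
      rw [← ofPath_cons, peel_ofPath]
      exact if_neg hb
    · rw [arrow, ofPath_mul_ofPath_of_ne k _ _ h, map_zero]
      rfl
  exact LinearMap.congr_fun this x

theorem idem_mul_peel (a : AllArrows V) (x : PathAlgebra k V) :
    idem k a.1 * peel k a x = peel k a x := by
  have : LinearMap.mulLeft k (idem k a.1) ∘ₗ peel k a = peel k a := by
    apply linearMap_ext
    intro i j p
    simp only [LinearMap.comp_apply, LinearMap.mulLeft_apply, peel_ofPath]
    cases p with
    | nil => exact mul_zero _
    | cons p b =>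
      rw [peelPath]
      split_ifs with h
      · subst h
        exact idem_mul_ofPath k p
      · exact mul_zero _
  exact LinearMap.congr_fun this x

theorem peel_idem_mul (a : AllArrows V) (x : PathAlgebra k V) :
    peel k a (idem k a.2.1 * x) = peel k a x := by
  have : peel k a ∘ₗ LinearMap.mulLeft k (idem k a.2.1) = peel k a := by
    apply linearMap_ext
    intro i j p
    simp only [LinearMap.comp_apply, LinearMap.mulLeft_apply]
    by_cases h : a.2.1 = j
    · subst h
      rw [idem_mul_ofPath]
    · rw [idem_mul_ofPath_of_ne k _ h, map_zero, peel_ofPath]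
      cases p with
      | nil => rfl
      | cons p b =>
        rw [peelPath, if_neg]
        rintro rfl
        exact h rfl
  exact LinearMap.congr_fun this x

theorem idemCoord_idem_mul (i : V) (x : PathAlgebra k V) :
    idemCoord k i (idem k i * x) = idemCoord k i x := by
  have : idemCoord k i ∘ₗ LinearMap.mulLeft k (idem k i) = idemCoord k i := by
    apply linearMap_ext
    intro i' j p
    simp only [LinearMap.comp_apply, LinearMap.mulLeft_apply]
    by_cases h : i = j
    · subst h
      rw [idem_mul_ofPath]
    · rw [idem_mul_ofPath_of_ne k _ h, map_zero]
      cases p with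
      | nil => exact (idemCoord_idem_of_ne k h).symm
      | cons p b => exact (idemCoord_ofPath_cons k i p b).symm
  exact LinearMap.congr_fun this x

variable [∀ i j : V, Fintype (i ⟶ j)]

/-- A path is trivial or has a last arrow. -/
theorem sum_idemCoord_add_sum_arrow_mul_peel (x : PathAlgebra k V) :
    ∑ i, idemCoord k i x • idem k i + ∑ a : AllArrows V, arrow k a.2.2 * peel k a x = x := by
  classical
  have : (∑ i : V, (idemCoord k i).smulRight (idem k i)) +
      ∑ a : AllArrows V, LinearMap.mulLeft k (arrow k a.2.2) ∘ₗ peel k a = LinearMap.id := by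
    apply linearMap_ext
    intro i j p
    simp only [LinearMap.add_apply, LinearMap.sum_apply, LinearMap.smulRight_apply,
      LinearMap.comp_apply, LinearMap.mulLeft_apply, LinearMap.id_apply]
    cases p with
    | nil =>
      change ∑ l, idemCoord k l (idem k i) • idem k l +
        ∑ a : AllArrows V, arrow k a.2.2 * peel k a (idem k i) = idem k i
      simp only [peel_idem, mul_zero, Finset.sum_const_zero, add_zero]
      rw [Finset.sum_eq_single i, idemCoord_idem, one_smul]
      · intro l _ hl
        rw [idemCoord_idem_of_ne k hl, zero_smul]
      · simp
    | @cons l _ p b =>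
      simp only [idemCoord_ofPath_cons, zero_smul, Finset.sum_const_zero, zero_add]
      rw [Finset.sum_eq_single (⟨l, j, b⟩ : AllArrows V)]
      · rw [ofPath_cons, peel_arrow_mul_self, idem_mul_ofPath]
      · intro a _ ha
        rw [ofPath_cons, peel_arrow_mul_of_ne k b (Ne.symm ha), mul_zero]
      · simp
  simpa using LinearMap.congr_fun this x

end Peel

/-! ### The standard resolution of `DA` by linear endomorphisms of `A` -/

section Resolution

open MulOpposite

variable (k : Type u) (V : Type v) [Field k] [Quiver.{w} V] [Fintype V]

/-- The linear endomorphisms of `kQ` that commute with the multiplication by vertices from the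
left. This is the projective right module `⨁ᵢ D(eᵢ A) ⊗ eᵢ A`. -/
def resolutionZero : Submodule (PathAlgebra k V)ᵐᵒᵖ (PathAlgebra k V →ₗ[k] PathAlgebra k V) where
  carrier := {φ | ∀ (i : V) (x : PathAlgebra k V), φ (idem k i * x) = idem k i * φ x}
  add_mem' hφ hψ i x := by
    rw [LinearMap.add_apply, LinearMap.add_apply, mul_add, hφ, hψ]
  zero_mem' _ _ := (mul_zero _).symm
  smul_mem' b φ hφ i x := by
    rw [LinearMap.smul_apply, LinearMap.smul_apply, hφ]
    exact mul_assoc _ _ _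

/-- The families of linear endomorphisms of `kQ`, indexed by the arrows `a : i → j`, that factor
through the multiplication by `j` and take values in `eᵢ kQ`. This is the projective right module
`⨁ₐ D(eⱼ A) ⊗ eᵢ A`. -/
def resolutionOne : Submodule (PathAlgebra k V)ᵐᵒᵖ
    (AllArrows V → PathAlgebra k V →ₗ[k] PathAlgebra k V) where
  carrier := {ψ | ∀ (a : AllArrows V) (x : PathAlgebra k V),
    ψ a (idem k a.2.1 * x) = ψ a x ∧ idem k a.1 * ψ a x = ψ a x}
  add_mem' hφ hψ a x := by
    simp only [Pi.add_apply, LinearMap.add_apply, mul_add, (hφ a x).1, (hφ a x).2, (hψ a x).1,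
      (hψ a x).2, and_self]
  zero_mem' _ _ := ⟨rfl, mul_zero _⟩
  smul_mem' b φ hφ a x := by
    rw [Pi.smul_apply, LinearMap.smul_apply, LinearMap.smul_apply, (hφ a x).1]
    exact ⟨rfl, (mul_assoc _ _ _).symm.trans (congrArg (· * b.unop) (hφ a x).2)⟩

variable {k V}

namespace resolutionZero

theorem smul_apply (b : (PathAlgebra k V)ᵐᵒᵖ) (φ : resolutionZero k V) (x : PathAlgebra k V) :
    (b • φ).1 x = φ.1 x * b.unop := rfl

variable (k V) in
/-- The left action of the path algebra. -/
noncomputable def leftMul (b : PathAlgebra k V) :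
    resolutionZero k V →ₗ[(PathAlgebra k V)ᵐᵒᵖ] resolutionZero k V where
  toFun φ := ⟨φ.1 ∘ₗ LinearMap.mulRight k b, fun i x => by
    simp only [LinearMap.comp_apply, LinearMap.mulRight_apply, mul_assoc, φ.2 i]⟩
  map_add' _ _ := Subtype.ext (LinearMap.ext fun _ => rfl)
  map_smul' c φ := Subtype.ext (LinearMap.ext fun x => by
    rw [RingHom.id_apply, smul_apply, LinearMap.comp_apply, LinearMap.comp_apply, smul_apply])

theorem leftMul_apply (b : PathAlgebra k V) (φ : resolutionZero k V) (x : PathAlgebra k V) :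
    (leftMul k V b φ).1 x = φ.1 (x * b) := rfl

/-- The element `f ⊗ eᵢ`. -/
noncomputable def tensor (f : PathAlgebra k V →ₗ[k] k) (i : V) : resolutionZero k V :=
  ⟨(f ∘ₗ LinearMap.mulLeft k (idem k i)).smulRight (idem k i), fun j x => by
    simp only [LinearMap.smulRight_apply, LinearMap.comp_apply, LinearMap.mulLeft_apply,
      mul_smul_comm, ← mul_assoc]
    by_cases h : i = j
    · subst h; simp
    · rw [idem_mul_idem_of_ne k h, idem_mul_idem_of_ne k (Ne.symm h), zero_mul, map_zero,
        zero_smul, smul_zero]⟩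

theorem tensor_apply (f : PathAlgebra k V →ₗ[k] k) (i : V) (x : PathAlgebra k V) :
    (tensor f i).1 x = f (idem k i * x) • idem k i := rfl

end resolutionZero

namespace resolutionOne

theorem smul_apply (b : (PathAlgebra k V)ᵐᵒᵖ) (ψ : resolutionOne k V) (a : AllArrows V)
    (x : PathAlgebra k V) : (b • ψ).1 a x = ψ.1 a x * b.unop := rfl

variable (k V) in
/-- The left action of the path algebra. -/
noncomputable def leftMul (b : PathAlgebra k V) :
    resolutionOne k V →ₗ[(PathAlgebra k V)ᵐᵒᵖ] resolutionOne k V where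
  toFun ψ := ⟨fun a => ψ.1 a ∘ₗ LinearMap.mulRight k b, fun a x => by
    simp only [LinearMap.comp_apply, LinearMap.mulRight_apply, mul_assoc, (ψ.2 a _).1, (ψ.2 a _).2,
      and_self]⟩
  map_add' _ _ := Subtype.ext (funext fun _ => LinearMap.ext fun _ => rfl)
  map_smul' c ψ := Subtype.ext (funext fun a => LinearMap.ext fun x => by
    rw [RingHom.id_apply, smul_apply, LinearMap.comp_apply, LinearMap.comp_apply, smul_apply])

theorem leftMul_apply (b : PathAlgebra k V) (ψ : resolutionOne k V) (a : AllArrows V)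
    (x : PathAlgebra k V) : (leftMul k V b ψ).1 a x = ψ.1 a (x * b) := rfl

theorem apply_idem_mul_of_ne (ψ : resolutionOne k V) (a : AllArrows V) {i : V} (h : a.2.1 ≠ i)
    (x : PathAlgebra k V) : ψ.1 a (idem k i * x) = 0 := by
  rw [← (ψ.2 a _).1, ← mul_assoc, idem_mul_idem_of_ne k h, zero_mul, map_zero]

theorem idem_mul_apply_of_ne (ψ : resolutionOne k V) (a : AllArrows V) {i : V} (h : i ≠ a.1)
    (x : PathAlgebra k V) : idem k i * ψ.1 a x = 0 := by
  rw [← (ψ.2 a _).2, ← mul_assoc, idem_mul_idem_of_ne k h, zero_mul]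

open Classical in
/-- The element `f ⊗ eᵢ` of the summand of an arrow `a : i → j`. -/
noncomputable def tensor (f : PathAlgebra k V →ₗ[k] k) (a : AllArrows V) : resolutionOne k V :=
  ⟨Pi.single a ((f ∘ₗ LinearMap.mulLeft k (idem k a.2.1)).smulRight (idem k a.1)), fun b x => by
    by_cases h : b = a
    · subst h
      simp [← mul_assoc]
    · simp [Pi.single_eq_of_ne h]⟩

theorem tensor_apply_self (f : PathAlgebra k V →ₗ[k] k) (a : AllArrows V) (x : PathAlgebra k V) :
    (tensor f a).1 a x = f (idem k a.2.1 * x) • idem k a.1 := by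
  simp [tensor]

theorem tensor_apply_of_ne (f : PathAlgebra k V →ₗ[k] k) {a b : AllArrows V} (h : b ≠ a)
    (x : PathAlgebra k V) : (tensor f a).1 b x = 0 := by
  classical
  simp [tensor, Pi.single_eq_of_ne h]

end resolutionOne

section Differential

variable [∀ i j : V, Fintype (i ⟶ j)]

variable (k V) in
/-- The differential of the standard resolution of `DA`. -/
noncomputable def resolutionD :
    resolutionOne k V →ₗ[(PathAlgebra k V)ᵐᵒᵖ] resolutionZero k V where
  toFun ψ := ⟨∑ a : AllArrows V, (ψ.1 a ∘ₗ LinearMap.mulLeft k (arrow k a.2.2) -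
      LinearMap.mulLeft k (arrow k a.2.2) ∘ₗ ψ.1 a), fun i x => by
    simp only [LinearMap.sum_apply, LinearMap.sub_apply, LinearMap.comp_apply,
      LinearMap.mulLeft_apply, Finset.mul_sum, mul_sub]
    rw [Finset.sum_sub_distrib, Finset.sum_sub_distrib]
    congr 1
    · refine Finset.sum_congr rfl fun a _ => ?_
      rw [← mul_assoc]
      by_cases h : a.1 = i
      · subst h
        rw [arrow_mul_idem, (ψ.2 a _).2]
      · rw [arrow_mul_idem_of_ne k _ h, zero_mul, map_zero,
          resolutionOne.idem_mul_apply_of_ne ψ a (Ne.symm h)]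
    · refine Finset.sum_congr rfl fun a _ => ?_
      rw [← mul_assoc]
      by_cases h : a.2.1 = i
      · subst h
        rw [idem_mul_arrow, (ψ.2 a _).1]
      · rw [idem_mul_arrow_of_ne k _ (Ne.symm h), zero_mul, resolutionOne.apply_idem_mul_of_ne ψ a h,
          mul_zero]⟩
  map_add' ψ ψ' := by
    ext x
    simp only [Submodule.coe_add, Pi.add_apply, LinearMap.sum_apply, LinearMap.sub_apply,
      LinearMap.comp_apply, LinearMap.mulLeft_apply, LinearMap.add_apply, mul_add]
    rw [← Finset.sum_add_distrib]
    exact Finset.sum_congr rfl fun a _ => by abel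
  map_smul' b ψ := by
    ext x
    simp only [RingHom.id_apply, LinearMap.sum_apply, LinearMap.sub_apply,
      LinearMap.comp_apply, LinearMap.mulLeft_apply, resolutionZero.smul_apply,
      resolutionOne.smul_apply, Finset.sum_mul, sub_mul, mul_assoc]

theorem resolutionD_apply (ψ : resolutionOne k V) (x : PathAlgebra k V) :
    (resolutionD k V ψ).1 x =
      ∑ a : AllArrows V, (ψ.1 a (arrow k a.2.2 * x) - arrow k a.2.2 * ψ.1 a x) := by
  simp [resolutionD, LinearMap.sum_apply]

end Differential

variable (k V) in
/-- The augmentation of the standard resolution of `DA`. -/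
noncomputable def resolutionAug :
    resolutionZero k V →ₗ[(PathAlgebra k V)ᵐᵒᵖ] DualModule.{u, max v w} k (PathAlgebra k V) where
  toFun φ :=
    { toFun := fun x => LinearMap.trace k (PathAlgebra k V) (LinearMap.mulRight k x ∘ₗ φ.1)
      map_add' := fun x y => by
        rw [← map_add, ← LinearMap.add_comp]
        congr 2
        exact LinearMap.ext fun z => mul_add z x y
      map_smul' := fun c x => by
        rw [RingHom.id_apply, ← map_smul, ← LinearMap.smul_comp]
        congr 2
        exact LinearMap.ext fun z => mul_smul_comm c z x }
  map_add' φ ψ := LinearMap.ext fun x => by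
    simp only [LinearMap.add_apply, LinearMap.coe_mk, AddHom.coe_mk, Submodule.coe_add,
      LinearMap.comp_add, map_add]
  map_smul' b φ := LinearMap.ext fun x =>
    congrArg (LinearMap.trace k (PathAlgebra k V))
      (LinearMap.ext fun y => mul_assoc (φ.1 y) b.unop x)

theorem resolutionAug_apply (φ : resolutionZero k V) (x : PathAlgebra k V) :
    resolutionAug k V φ x =
      LinearMap.trace k (PathAlgebra k V) (LinearMap.mulRight k x ∘ₗ φ.1) := rfl

end Resolution

end PathAlgebra

namespace PathAlgebra

/-! ### Exactness of the standard resolution and projectivity of its middle term -/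

section Exactness

open MulOpposite

variable {k : Type u} {V : Type v} [Field k] [Quiver.{w} V] [Fintype V]
  [∀ i j : V, Fintype (i ⟶ j)]

/-- The operator `θ ↦ (x ↦ ∑ₐ ∂ₐ θ(a x))`, where `∂ₐ` removes a last arrow `a`. -/
noncomputable def peelConj (θ : PathAlgebra k V →ₗ[k] PathAlgebra k V) :
    PathAlgebra k V →ₗ[k] PathAlgebra k V :=
  ∑ a : AllArrows V, peel k a ∘ₗ θ ∘ₗ LinearMap.mulLeft k (arrow k a.2.2)

theorem peelConj_apply (θ : PathAlgebra k V →ₗ[k] PathAlgebra k V) (x : PathAlgebra k V) :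
    peelConj θ x = ∑ a : AllArrows V, peel k a (θ (arrow k a.2.2 * x)) := by
  simp [peelConj, LinearMap.sum_apply]

theorem peelConj_mem (θ : PathAlgebra k V →ₗ[k] PathAlgebra k V) :
    peelConj θ ∈ resolutionZero k V := by
  intro i x
  rw [peelConj_apply, peelConj_apply, Finset.mul_sum]
  refine Finset.sum_congr rfl fun a _ => ?_
  rw [← mul_assoc]
  by_cases h : a.1 = i
  · subst h
    rw [arrow_mul_idem, idem_mul_peel]
  · rw [arrow_mul_idem_of_ne k _ h, zero_mul, map_zero, map_zero, ← idem_mul_peel, ← mul_assoc,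
      idem_mul_idem_of_ne k (Ne.symm h), zero_mul]

/-- The operator `peelConj` evaluates its argument on paths that are one arrow longer, so it lowers
by one the length from which a map vanishes. It is thus nilpotent on maps vanishing on long paths,
and `θ` is the geometric series `φ + peelConj φ + ⋯`. -/
theorem exists_sub_peelConj_eq (n : ℕ) :
    ∀ φ ∈ resolutionZero k V, (∀ x ∈ lengthGE k V n, φ x = 0) →
      ∃ θ ∈ resolutionZero k V, θ - peelConj θ = φ := by
  induction n with
  | zero =>
    intro φ _ hφ
    refine ⟨0, Submodule.zero_mem _, LinearMap.ext fun x => ?_⟩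
    rw [hφ x (mem_lengthGE_zero x), LinearMap.sub_apply, peelConj_apply]
    simp
  | succ n ih =>
    intro φ hφ hφ'
    obtain ⟨θ, hθ, h⟩ := ih (peelConj φ) (peelConj_mem φ) fun x hx => by
      rw [peelConj_apply]
      exact Finset.sum_eq_zero fun a _ => by
        rw [hφ' _ (arrow_mul_mem_lengthGE _ hx), map_zero]
    refine ⟨φ + θ, Submodule.add_mem _ hφ hθ, LinearMap.ext fun x => ?_⟩
    have h' := LinearMap.congr_fun h x
    simp only [LinearMap.sub_apply, LinearMap.add_apply, peelConj_apply, map_add,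
      Finset.sum_add_distrib] at h' ⊢
    rw [← h']
    abel

variable [Finite (AllPaths V)]

/-- Removing last arrows from the equation `D ψ = 0` expresses each value of `ψ` through values of
`ψ` at longer paths. Iteration leaves the range of existing paths. -/
theorem resolutionD_injective : Function.Injective (resolutionD k V) := by
  rw [injective_iff_map_eq_zero]
  intro ψ hψ
  obtain ⟨N, hN⟩ := exists_length_lt (V := V)
  -- Apply `peel k a` to the vanishing value of the differential at `x`. Among the terms `b ψ_b(x)`
  -- only `b = a` survives, and it returns `ψ_a(x)`.
  have h : ∀ a x, ψ.1 a x = ∑ b : AllArrows V, peel k a (ψ.1 b (arrow k b.2.2 * x)) := by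
    intro a x
    have h0 : peel k a ((resolutionD k V ψ).1 x) = 0 := by
      rw [hψ]; exact map_zero _
    rw [resolutionD_apply, Finset.sum_sub_distrib, map_sub, map_sum, map_sum,
      Finset.sum_eq_single (f := fun b : AllArrows V => peel k a (arrow k b.2.2 * ψ.1 b x)) a,
      peel_arrow_mul_self, (ψ.2 a x).2, sub_eq_zero] at h0
    · exact h0.symm
    · intro b _ hb
      exact peel_arrow_mul_of_ne k _ hb _
    · simp
  -- Descending induction on the length `m`, starting at `N`, where there are no paths left.
  have h' : ∀ n m, n + m = N → ∀ a, ∀ x ∈ lengthGE k V m, ψ.1 a x = 0 := by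
    intro n
    induction n with
    | zero =>
      intro m hm a x hx
      obtain rfl : m = N := by omega
      rw [lengthGE_eq_bot hN, Submodule.mem_bot] at hx
      rw [hx, map_zero]
    | succ n ih =>
      intro m hm a x hx
      rw [h]
      exact Finset.sum_eq_zero fun b _ => by
        rw [ih (m + 1) (by omega) b _ (arrow_mul_mem_lengthGE _ hx), map_zero]
  exact Subtype.ext (funext fun a => LinearMap.ext fun x =>
    h' N 0 (by omega) a x (mem_lengthGE_zero x))

omit [∀ i j : V, Fintype (i ⟶ j)] in
-- The endomorphism in question has rank at most one, so its trace is the functional evaluated at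
-- the vector. Under the identification with tensors, the augmentation is thus the action map `f ⊗
-- eᵢ ↦ f eᵢ`.
theorem resolutionAug_tensor (f : PathAlgebra k V →ₗ[k] k) (i : V) (x : PathAlgebra k V) :
    resolutionAug k V (resolutionZero.tensor f i) x = f (idem k i * x) := by
  rw [resolutionAug_apply]
  have : LinearMap.mulRight k x ∘ₗ (resolutionZero.tensor f i).1 =
      (f ∘ₗ LinearMap.mulLeft k (idem k i)).smulRight (idem k i * x) := by
    ext y
    simp [resolutionZero.tensor_apply]
  rw [this, LinearMap.trace_smulRight]
  simp [← mul_assoc]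

omit [∀ i j : V, Fintype (i ⟶ j)] in
theorem resolutionAug_surjective : Function.Surjective (resolutionAug k V) := by
  intro f
  refine ⟨∑ i, resolutionZero.tensor f i, LinearMap.ext fun x => ?_⟩
  rw [map_sum, LinearMap.sum_apply]
  simp_rw [resolutionAug_tensor]
  rw [← map_sum, sum_idem_mul]

/-- Right multiplication commutes with left multiplication by an arrow, so the trace is taken of a
sum of commutators. -/
theorem resolutionAug_resolutionD (ψ : resolutionOne k V) :
    resolutionAug k V (resolutionD k V ψ) = 0 := by
  ext x
  have : LinearMap.mulRight k x ∘ₗ (resolutionD k V ψ).1 = ∑ a : AllArrows V,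
      ((LinearMap.mulRight k x ∘ₗ ψ.1 a) ∘ₗ LinearMap.mulLeft k (arrow k a.2.2) -
        LinearMap.mulLeft k (arrow k a.2.2) ∘ₗ (LinearMap.mulRight k x ∘ₗ ψ.1 a)) := by
    ext y
    simp [resolutionD_apply, LinearMap.sum_apply, Finset.sum_mul, sub_mul, mul_assoc]
  rw [resolutionAug_apply, this, map_sum]
  refine Finset.sum_eq_zero fun a _ => ?_
  rw [map_sub, LinearMap.trace_comp_comm', sub_self]

/-- Writing `φ = θ - peelConj θ` and splitting `θ x` into its trivial part and its parts with a last
arrow shows that `φ` is a boundary up to `∑ cᵢ ⊗ eᵢ`, where `cᵢ` is the coefficient of `eᵢ` in `θ`.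
The augmentation is injective on such sums, so this remainder vanishes when `φ` is a cycle. -/
theorem exists_resolutionD_eq {φ : resolutionZero k V} (hφ : resolutionAug k V φ = 0) :
    ∃ ψ, resolutionD k V ψ = φ := by
  obtain ⟨N, hN⟩ := exists_length_lt (V := V)
  obtain ⟨θ, hθ, h⟩ := exists_sub_peelConj_eq N φ.1 φ.2 fun x hx => by
    rw [lengthGE_eq_bot hN, Submodule.mem_bot] at hx
    rw [hx, map_zero]
  -- The sign turns the term `-a ψₐ(x)` of the differential into `a ∂ₐ θ(x)`, the part of `θ x`
  -- ending in `a`.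
  let ψ : resolutionOne k V := ⟨fun a => -(peel k a ∘ₗ θ), fun a x => by
    simp only [LinearMap.neg_apply, LinearMap.comp_apply, hθ a.2.1 x, peel_idem_mul,
      mul_neg, idem_mul_peel, and_self]⟩
  have hψ : ∀ x, φ.1 x = (resolutionD k V ψ).1 x + ∑ i, idemCoord k i (θ x) • idem k i := by
    intro x
    rw [← h, resolutionD_apply, LinearMap.sub_apply, peelConj_apply]
    nth_rw 1 [← sum_idemCoord_add_sum_arrow_mul_peel k (θ x)]
    simp only [ψ, LinearMap.neg_apply, LinearMap.comp_apply, Finset.sum_sub_distrib,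
      Finset.sum_neg_distrib, mul_neg]
    abel
  have hθ' : φ = resolutionD k V ψ + ∑ i, resolutionZero.tensor (idemCoord k i ∘ₗ θ) i := by
    refine Subtype.ext (LinearMap.ext fun x => (hψ x).trans ?_)
    rw [Submodule.coe_add, LinearMap.add_apply, Submodule.coe_sum, LinearMap.sum_apply]
    congr 1
    refine Finset.sum_congr rfl fun i _ => ?_
    rw [resolutionZero.tensor_apply, LinearMap.comp_apply, hθ, idemCoord_idem_mul]
  have hT : ∀ x, ∑ i, idemCoord k i (θ x) = 0 := by
    intro x
    have := LinearMap.congr_fun hφ x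
    rw [hθ', map_add, resolutionAug_resolutionD, zero_add, map_sum, LinearMap.sum_apply] at this
    refine Eq.trans ?_ this
    refine Finset.sum_congr rfl fun i _ => ?_
    rw [resolutionAug_tensor, LinearMap.comp_apply, hθ, idemCoord_idem_mul]
  -- Evaluating the sum at `eᵢ x` isolates its summand at `i`.
  have hz : ∀ i x, idemCoord k i (θ x) = 0 := by
    intro i x
    rw [← hT (idem k i * x), Finset.sum_eq_single i, hθ, idemCoord_idem_mul]
    · intro j _ hj
      rw [hθ, ← idemCoord_idem_mul, ← mul_assoc, idem_mul_idem_of_ne k hj, zero_mul, map_zero]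
    · simp
  refine ⟨ψ, Subtype.ext (LinearMap.ext fun x => ?_)⟩
  rw [hψ x]
  simp [hz]

omit [∀ i j : V, Fintype (i ⟶ j)] in
variable (k V) in
-- All linear endomorphisms of `A` form a free right module, since there are only finitely many
-- paths and each may be sent anywhere. Those commuting with the vertices are a direct summand.
theorem projective_resolutionZero :
    Module.Projective (PathAlgebra k V)ᵐᵒᵖ (resolutionZero k V) := by
  let O : (PathAlgebra k V)ᵐᵒᵖ ≃ₗ[(PathAlgebra k V)ᵐᵒᵖ] PathAlgebra k V :=
    (opLinearEquiv (PathAlgebra k V)ᵐᵒᵖ).symm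
  have hO : Module.Free (PathAlgebra k V)ᵐᵒᵖ (PathAlgebra k V) := .of_equiv O
  have hE : Module.Free (PathAlgebra k V)ᵐᵒᵖ (PathAlgebra k V →ₗ[k] PathAlgebra k V) :=
    .of_equiv ((pathBasis k V).constr (PathAlgebra k V)ᵐᵒᵖ)
  -- The retraction takes the block diagonal part with respect to the vertex idempotents, which is
  -- everything for maps already commuting with them.
  let r : (PathAlgebra k V →ₗ[k] PathAlgebra k V) →ₗ[(PathAlgebra k V)ᵐᵒᵖ] resolutionZero k V :=
    { toFun := fun φ => ⟨∑ i, LinearMap.mulLeft k (idem k i) ∘ₗ φ ∘ₗ LinearMap.mulLeft k (idem k i),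
        fun j x => by
          simp only [LinearMap.sum_apply, LinearMap.comp_apply, LinearMap.mulLeft_apply,
            Finset.mul_sum, ← mul_assoc]
          refine Finset.sum_congr rfl fun i _ => ?_
          by_cases h : i = j
          · subst h; simp
          · rw [idem_mul_idem_of_ne k h, idem_mul_idem_of_ne k (Ne.symm h), zero_mul, zero_mul,
              map_zero, mul_zero]⟩
      map_add' := fun φ ψ => Subtype.ext (LinearMap.ext fun x => by
        simp [LinearMap.sum_apply, mul_add, Finset.sum_add_distrib])
      map_smul' := fun b φ => Subtype.ext (LinearMap.ext fun x => by
        rw [RingHom.id_apply, resolutionZero.smul_apply]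
        simp [LinearMap.sum_apply, Finset.sum_mul, mul_assoc]) }
  refine Module.Projective.of_split (resolutionZero k V).subtype r
    (LinearMap.ext fun φ => Subtype.ext (LinearMap.ext fun x => ?_))
  change (∑ i, LinearMap.mulLeft k (idem k i) ∘ₗ φ.1 ∘ₗ LinearMap.mulLeft k (idem k i)) x = φ.1 x
  rw [LinearMap.sum_apply, ← sum_idem_mul k (φ.1 x)]
  refine Finset.sum_congr rfl fun i _ => ?_
  rw [LinearMap.comp_apply, LinearMap.comp_apply, LinearMap.mulLeft_apply, LinearMap.mulLeft_apply,
    φ.2, ← mul_assoc, idem_mul_idem]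

end Exactness

end PathAlgebra

/-! ### First extension groups from a short exact sequence -/

namespace CategoryTheory.ShortComplex.ShortExact

open Abelian

variable {C : Type*} [Category* C] [Abelian C] [HasExt.{t} C] {S : ShortComplex C}
  (hS : S.ShortExact) {Y : C}

theorem extClass_comp_mk₀_add (f g : S.X₁ ⟶ Y) :
    hS.extClass.comp (Ext.mk₀ (f + g)) (add_zero 1) =
      hS.extClass.comp (Ext.mk₀ f) (add_zero 1) + hS.extClass.comp (Ext.mk₀ g) (add_zero 1) := by
  rw [Ext.mk₀_add, Ext.comp_add]

theorem extClass_comp_mk₀_comp_mk₀ {Z : C} (f : S.X₁ ⟶ Y) (g : Y ⟶ Z) :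
    (hS.extClass.comp (Ext.mk₀ f) (add_zero 1)).comp (Ext.mk₀ g) (add_zero 1) =
      hS.extClass.comp (Ext.mk₀ (f ≫ g)) (add_zero 1) := by
  rw [Ext.comp_assoc_of_third_deg_zero, Ext.mk₀_comp_mk₀]

/-- Naturality of the extension class: an endomorphism of the quotient that lifts to the sequence
acts on `Ext¹` through its restriction to the kernel. This computes the right action on `Ext¹(DA,
A)`. -/
theorem mk₀_comp_extClass_comp_mk₀ (φ : S ⟶ S) (f : S.X₁ ⟶ Y) :
    (Ext.mk₀ φ.τ₃).comp (hS.extClass.comp (Ext.mk₀ f) (add_zero 1)) (zero_add 1) =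
      hS.extClass.comp (Ext.mk₀ (φ.τ₁ ≫ f)) (add_zero 1) := by
  rw [← Ext.comp_assoc_of_third_deg_zero, ← extClass_naturality hS hS,
    Ext.comp_assoc_of_third_deg_zero, Ext.mk₀_comp_mk₀]

/-- By the long exact sequence, the obstruction lies in `Ext¹(S.X₂, Y)`, which is zero. -/
theorem exists_extClass_comp_mk₀_eq (h : Projective S.X₂) (x : Ext S.X₃ Y 1) :
    ∃ f : S.X₁ ⟶ Y, hS.extClass.comp (Ext.mk₀ f) (add_zero 1) = x := by
  obtain ⟨x₁, hx₁⟩ := Ext.contravariant_sequence_exact₃ hS Y x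
    (Ext.eq_zero_of_projective _) (add_zero 1)
  obtain ⟨f, rfl⟩ := (Ext.mk₀_bijective _ _).2 x₁
  exact ⟨f, hx₁⟩

theorem extClass_comp_mk₀_eq_zero_iff (f : S.X₁ ⟶ Y) :
    hS.extClass.comp (Ext.mk₀ f) (add_zero 1) = 0 ↔ ∃ g : S.X₂ ⟶ Y, S.f ≫ g = f := by
  constructor
  · intro h
    obtain ⟨x₂, hx₂⟩ := Ext.contravariant_sequence_exact₁ hS Y _ (add_zero 1) h
    obtain ⟨g, rfl⟩ := (Ext.mk₀_bijective _ _).2 x₂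
    rw [Ext.mk₀_comp_mk₀] at hx₂
    exact ⟨g, (Ext.mk₀_bijective _ _).1 hx₂⟩
  · rintro ⟨g, rfl⟩
    rw [← Ext.mk₀_comp_mk₀]
    exact extClass_comp_assoc _ _

end CategoryTheory.ShortComplex.ShortExact

namespace PathAlgebra

/-! ### `Ext¹(DA, A)` as a quotient of the homomorphisms from the first syzygy to `A` -/

section ExtDual

open MulOpposite CategoryTheory.Abelian

variable {k : Type u} {V : Type v} [Field k] [Quiver.{w} V] [Fintype V]
  [∀ i j : V, Fintype (i ⟶ j)]

omit [∀ i j : V, Fintype (i ⟶ j)] in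
-- Cyclic invariance of the trace moves the right multiplication by `b` from the input of `φ` to its
-- output.
theorem resolutionAug_leftMul [Finite (AllPaths V)] (b : PathAlgebra k V) (φ : resolutionZero k V) :
    resolutionAug k V (resolutionZero.leftMul k V b φ) =
      (dualLeft.{u, max v w} k b).hom (resolutionAug k V φ) := by
  refine LinearMap.ext fun x => ?_
  change LinearMap.trace k (PathAlgebra k V)
    (LinearMap.mulRight k x ∘ₗ (φ.1 ∘ₗ LinearMap.mulRight k b)) =
      LinearMap.trace k (PathAlgebra k V) (LinearMap.mulRight k (x * b) ∘ₗ φ.1)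
  rw [← LinearMap.comp_assoc, LinearMap.trace_comp_comm', ← LinearMap.comp_assoc]
  congr 2
  exact LinearMap.ext fun y => mul_assoc y x b

theorem resolutionD_leftMul (b : PathAlgebra k V) (ψ : resolutionOne k V) :
    resolutionD k V (resolutionOne.leftMul k V b ψ) =
      resolutionZero.leftMul k V b (resolutionD k V ψ) := by
  refine Subtype.ext (LinearMap.ext fun x => ?_)
  rw [resolutionZero.leftMul_apply, resolutionD_apply, resolutionD_apply]
  simp only [resolutionOne.leftMul_apply, mul_assoc]

variable (k V) in
/-- The standard resolution of `DA`, as a short complex of right modules. -/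
noncomputable abbrev resolutionComplex [Finite (AllPaths V)] :
    ShortComplex (ModuleCat.{max u v w} (PathAlgebra k V)ᵐᵒᵖ) where
  X₁ := ModuleCat.of _ (resolutionOne k V)
  X₂ := ModuleCat.of _ (resolutionZero k V)
  X₃ := rightDual.{u, max v w} k (PathAlgebra k V)
  f := ModuleCat.ofHom (resolutionD k V)
  g := ModuleCat.ofHom (Y := DualModule.{u, max v w} k (PathAlgebra k V)) (resolutionAug k V)
  zero := ConcreteCategory.hom_ext _ _ fun ψ => resolutionAug_resolutionD ψ

variable [Finite (AllPaths V)]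

variable (k V) in
theorem resolutionComplex_shortExact : (resolutionComplex k V).ShortExact where
  exact := by
    rw [ShortComplex.moduleCat_exact_iff]
    exact fun φ hφ => exists_resolutionD_eq hφ
  mono_f := (ModuleCat.mono_iff_injective _).mpr resolutionD_injective
  epi_g := (ModuleCat.epi_iff_surjective _).mpr resolutionAug_surjective

/-- The endomorphism of the standard resolution of `DA` given by the left action. -/
noncomputable def resolutionLeft (b : PathAlgebra k V) :
    resolutionComplex k V ⟶ resolutionComplex k V where
  τ₁ := ModuleCat.ofHom (resolutionOne.leftMul k V b)
  τ₂ := ModuleCat.ofHom (resolutionZero.leftMul k V b)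
  τ₃ := dualLeft.{u, max v w} k b
  comm₁₂ := ConcreteCategory.hom_ext _ _ fun ψ => resolutionD_leftMul b ψ
  comm₂₃ := ConcreteCategory.hom_ext _ _ fun φ => resolutionAug_leftMul b φ

/-- The element of `Ext¹(DA, A)` given by a homomorphism from the first syzygy of `DA` to `A`. -/
noncomputable def extMk (Θ : resolutionOne k V →ₗ[(PathAlgebra k V)ᵐᵒᵖ] PathAlgebra k V) :
    ExtDual.{u, max v w} k (PathAlgebra k V) 1 :=
  (resolutionComplex_shortExact k V).extClass.comp
    (Ext.mk₀ (ModuleCat.ofHom Θ : (resolutionComplex k V).X₁ ⟶ rightRegular (PathAlgebra k V)))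
    (add_zero 1)

theorem extMk_add (Θ Θ' : resolutionOne k V →ₗ[(PathAlgebra k V)ᵐᵒᵖ] PathAlgebra k V) :
    extMk (Θ + Θ') = extMk Θ + extMk Θ' :=
  (resolutionComplex_shortExact k V).extClass_comp_mk₀_add (Y := rightRegular (PathAlgebra k V))
    (ModuleCat.ofHom Θ) (ModuleCat.ofHom Θ')

omit [∀ i j : V, Fintype (i ⟶ j)] [Finite (AllPaths V)] in
/-- Left multiplication on `A` as a homomorphism of right modules. -/
noncomputable def mulLeftHom (b : PathAlgebra k V) :
    PathAlgebra k V →ₗ[(PathAlgebra k V)ᵐᵒᵖ] PathAlgebra k V :=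
  (regularLeft b).hom

omit [∀ i j : V, Fintype (i ⟶ j)] [Finite (AllPaths V)] in
theorem mulLeftHom_apply (b x : PathAlgebra k V) : mulLeftHom b x = b * x := rfl

theorem smul_extMk (b : PathAlgebra k V)
    (Θ : resolutionOne k V →ₗ[(PathAlgebra k V)ᵐᵒᵖ] PathAlgebra k V) :
    b • extMk Θ = extMk (mulLeftHom b ∘ₗ Θ) :=
  (resolutionComplex_shortExact k V).extClass_comp_mk₀_comp_mk₀
    (Y := rightRegular (PathAlgebra k V)) (ModuleCat.ofHom Θ) (regularLeft b)

/-- The right action comes from the left action on `DA`, which `resolutionLeft` lifts to the whole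
resolution. -/
theorem op_smul_extMk (b : PathAlgebra k V)
    (Θ : resolutionOne k V →ₗ[(PathAlgebra k V)ᵐᵒᵖ] PathAlgebra k V) :
    op b • extMk Θ = extMk (Θ ∘ₗ resolutionOne.leftMul k V b) :=
  (resolutionComplex_shortExact k V).mk₀_comp_extClass_comp_mk₀
    (Y := rightRegular (PathAlgebra k V)) (resolutionLeft b) (ModuleCat.ofHom Θ)

theorem extMk_surjective : Function.Surjective (extMk (k := k) (V := V)) := by
  intro x
  obtain ⟨f, hf⟩ := (resolutionComplex_shortExact k V).exists_extClass_comp_mk₀_eq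
    (Y := rightRegular (PathAlgebra k V))
    ((IsProjective.iff_projective (resolutionZero k V)).mp (projective_resolutionZero k V)) x
  exact ⟨f.hom, hf⟩

/-- The coboundaries: a pushout of the resolution splits exactly when the homomorphism extends to
the middle term. -/
theorem extMk_eq_zero_iff (Θ : resolutionOne k V →ₗ[(PathAlgebra k V)ᵐᵒᵖ] PathAlgebra k V) :
    extMk Θ = 0 ↔ ∃ Φ : resolutionZero k V →ₗ[(PathAlgebra k V)ᵐᵒᵖ] PathAlgebra k V,
      Φ ∘ₗ resolutionD k V = Θ := by
  refine ((resolutionComplex_shortExact k V).extClass_comp_mk₀_eq_zero_iff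
    (Y := rightRegular (PathAlgebra k V)) (ModuleCat.ofHom Θ)).trans ⟨?_, ?_⟩
  · rintro ⟨g, hg⟩
    exact ⟨g.hom, congrArg ModuleCat.Hom.hom hg⟩
  · rintro ⟨Φ, rfl⟩
    exact ⟨ModuleCat.ofHom Φ, rfl⟩

end ExtDual

end PathAlgebra

namespace PathAlgebra

/-! ### Dual bases of `A` and `DA` -/

section Coordinates

variable {k : Type u} {V : Type v} [Field k] [Quiver.{w} V]

variable (k V) in
/-- The functional picking the coefficient of a path. -/
noncomputable def pathCoord (p : AllPaths V) : PathAlgebra k V →ₗ[k] k := (pathBasis k V).coord p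

theorem sum_pathCoord_smul [Fintype (AllPaths V)] (x : PathAlgebra k V) :
    ∑ p : AllPaths V, pathCoord k V p x • ofPath k p.2.2 = x :=
  (pathBasis k V).sum_repr x

theorem sum_smul_pathCoord [Fintype (AllPaths V)] (f : PathAlgebra k V →ₗ[k] k) :
    ∑ p : AllPaths V, f (ofPath k p.2.2) • pathCoord k V p = f := by
  ext x
  nth_rw 2 [← sum_pathCoord_smul x]
  simp [LinearMap.sum_apply, mul_comm]

/-- Both sides evaluate the tensor in `DA ⊗ A` corresponding to `T` under `DA ⊗ A = End_k(A)`: the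
identity tensor `∑ p* ⊗ p` may absorb `T` in either factor. -/
theorem sum_apply_pathCoord_comp_mul [Fintype (AllPaths V)] {C : Type*} [Ring C] [Algebra k C]
    (F : (PathAlgebra k V →ₗ[k] k) →ₗ[k] C) (G : PathAlgebra k V →ₗ[k] C)
    (T : PathAlgebra k V →ₗ[k] PathAlgebra k V) :
    ∑ p : AllPaths V, F (pathCoord k V p ∘ₗ T) * G (ofPath k p.2.2) =
      ∑ p : AllPaths V, F (pathCoord k V p) * G (T (ofPath k p.2.2)) := by
  have h : ∀ p : AllPaths V, F (pathCoord k V p ∘ₗ T) =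
      ∑ q : AllPaths V, pathCoord k V p (T (ofPath k q.2.2)) • F (pathCoord k V q) := by
    intro p
    conv_lhs => rw [← sum_smul_pathCoord (pathCoord k V p ∘ₗ T)]
    simp
  have h' : ∀ q : AllPaths V, G (T (ofPath k q.2.2)) =
      ∑ p : AllPaths V, pathCoord k V p (T (ofPath k q.2.2)) • G (ofPath k p.2.2) := by
    intro q
    conv_lhs => rw [← sum_pathCoord_smul (T (ofPath k q.2.2))]
    simp
  simp_rw [h, h', Finset.sum_mul, Finset.mul_sum]
  rw [Finset.sum_comm]
  simp only [smul_mul_assoc, mul_smul_comm]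

end Coordinates

/-! ### Generators and relations of the bimodule `Ext¹(DA, A)` -/

section Presentation

open MulOpposite

variable {k : Type u} {V : Type v} [Field k] [Quiver.{w} V] [Fintype V]

/-- Evaluation at `p`, as a homomorphism of right modules. -/
noncomputable def evalZero (p : PathAlgebra k V) :
    resolutionZero k V →ₗ[(PathAlgebra k V)ᵐᵒᵖ] PathAlgebra k V where
  toFun φ := φ.1 p
  map_add' _ _ := rfl
  map_smul' _ _ := rfl

theorem evalZero_apply (p : PathAlgebra k V) (φ : resolutionZero k V) : evalZero p φ = φ.1 p := rfl

/-- Evaluation of the component of the arrow `a` at `p`, as a homomorphism of right modules. -/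
noncomputable def evalOne (a : AllArrows V) (p : PathAlgebra k V) :
    resolutionOne k V →ₗ[(PathAlgebra k V)ᵐᵒᵖ] PathAlgebra k V where
  toFun ψ := ψ.1 a p
  map_add' _ _ := rfl
  map_smul' _ _ := rfl

theorem evalOne_apply (a : AllArrows V) (p : PathAlgebra k V) (ψ : resolutionOne k V) :
    evalOne a p ψ = ψ.1 a p := rfl

namespace resolutionZero

theorem tensor_add (f g : PathAlgebra k V →ₗ[k] k) (i : V) :
    tensor (f + g) i = tensor f i + tensor g i :=
  Subtype.ext (LinearMap.ext fun x => by
    rw [Submodule.coe_add, LinearMap.add_apply]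
    simp only [tensor_apply, LinearMap.add_apply, add_smul])

/-- Scalars are moved into the right action because homomorphisms are linear over the opposite
algebra; this is what makes `onTensor` linear over `k`. -/
theorem tensor_smul (c : k) (f : PathAlgebra k V →ₗ[k] k) (i : V) :
    tensor (c • f) i = op (algebraMap k (PathAlgebra k V) c) • tensor f i :=
  Subtype.ext (LinearMap.ext fun x => by
    rw [smul_apply, tensor_apply, tensor_apply, LinearMap.smul_apply, unop_op,
      ← Algebra.commutes, ← Algebra.smul_def, smul_assoc])

/-- A homomorphism on the tensors `f ⊗ eᵢ`, as a linear map in `f`. -/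
noncomputable def onTensor (Φ : resolutionZero k V →ₗ[(PathAlgebra k V)ᵐᵒᵖ] PathAlgebra k V)
    (i : V) : (PathAlgebra k V →ₗ[k] k) →ₗ[k] PathAlgebra k V where
  toFun f := Φ (tensor f i)
  map_add' f g := by rw [tensor_add, map_add]
  map_smul' c f := by
    rw [tensor_smul, map_smul, op_smul_eq_mul, ← Algebra.commutes, ← Algebra.smul_def,
      RingHom.id_apply]

theorem onTensor_apply (Φ : resolutionZero k V →ₗ[(PathAlgebra k V)ᵐᵒᵖ] PathAlgebra k V)
    (i : V) (f : PathAlgebra k V →ₗ[k] k) : onTensor Φ i f = Φ (tensor f i) := rfl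

end resolutionZero

namespace resolutionOne

theorem tensor_add (f g : PathAlgebra k V →ₗ[k] k) (a : AllArrows V) :
    tensor (f + g) a = tensor f a + tensor g a :=
  Subtype.ext (funext fun b => LinearMap.ext fun x => by
    rw [Submodule.coe_add, Pi.add_apply, LinearMap.add_apply]
    by_cases h : b = a
    · subst h
      simp only [tensor_apply_self, LinearMap.add_apply, add_smul]
    · simp only [tensor_apply_of_ne _ h, add_zero])

theorem tensor_smul (c : k) (f : PathAlgebra k V →ₗ[k] k) (a : AllArrows V) :
    tensor (c • f) a = op (algebraMap k (PathAlgebra k V) c) • tensor f a :=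
  Subtype.ext (funext fun b => LinearMap.ext fun x => by
    rw [smul_apply]
    by_cases h : b = a
    · subst h
      rw [tensor_apply_self, tensor_apply_self, LinearMap.smul_apply, unop_op,
        ← Algebra.commutes, ← Algebra.smul_def, smul_assoc]
    · rw [tensor_apply_of_ne _ h, tensor_apply_of_ne _ h, zero_mul])

/-- A homomorphism on the tensors `f ⊗ eᵢ`, as a linear map in `f`. -/
noncomputable def onTensor (Θ : resolutionOne k V →ₗ[(PathAlgebra k V)ᵐᵒᵖ] PathAlgebra k V)
    (a : AllArrows V) : (PathAlgebra k V →ₗ[k] k) →ₗ[k] PathAlgebra k V where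
  toFun f := Θ (tensor f a)
  map_add' f g := by rw [tensor_add, map_add]
  map_smul' c f := by
    rw [tensor_smul, map_smul, op_smul_eq_mul, ← Algebra.commutes, ← Algebra.smul_def,
      RingHom.id_apply]

theorem onTensor_apply (Θ : resolutionOne k V →ₗ[(PathAlgebra k V)ᵐᵒᵖ] PathAlgebra k V)
    (a : AllArrows V) (f : PathAlgebra k V →ₗ[k] k) : onTensor Θ a f = Θ (tensor f a) := rfl

theorem leftMul_tensor (b : PathAlgebra k V) (f : PathAlgebra k V →ₗ[k] k) (a : AllArrows V) :
    leftMul k V b (tensor f a) = tensor (f ∘ₗ LinearMap.mulRight k b) a :=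
  Subtype.ext (funext fun a' => LinearMap.ext fun x => by
    rw [leftMul_apply]
    by_cases h : a' = a
    · subst h
      simp only [tensor_apply_self, LinearMap.comp_apply, LinearMap.mulRight_apply, mul_assoc]
    · rw [tensor_apply_of_ne _ h, tensor_apply_of_ne _ h])

end resolutionOne

variable [∀ i j : V, Fintype (i ⟶ j)]

/-- In tensor notation, `f ⊗ eᵢ ↦ f a ⊗ eᵢ - f ⊗ a` for `a : i → j`. -/
theorem resolutionD_tensor (f : PathAlgebra k V →ₗ[k] k) (a : AllArrows V) :
    resolutionD k V (resolutionOne.tensor f a) =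
      resolutionZero.tensor (f ∘ₗ LinearMap.mulLeft k (arrow k a.2.2)) a.1 -
        op (arrow k a.2.2) • resolutionZero.tensor f a.2.1 := by
  refine Subtype.ext (LinearMap.ext fun x => ?_)
  rw [resolutionD_apply, Finset.sum_eq_single a]
  · rw [AddSubgroupClass.coe_sub, LinearMap.sub_apply, resolutionZero.smul_apply,
      resolutionZero.tensor_apply, resolutionZero.tensor_apply, resolutionOne.tensor_apply_self,
      resolutionOne.tensor_apply_self]
    simp [← mul_assoc]
  · intro b _ hb
    rw [resolutionOne.tensor_apply_of_ne _ hb, resolutionOne.tensor_apply_of_ne _ hb, mul_zero,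
      sub_zero]
  · simp

/-- Expansion in the dual bases: the tensors generate the syzygy, so a homomorphism on it is
determined by its values on them. -/
theorem resolutionOne.sum_smul_tensor [Fintype (AllPaths V)] (ψ : resolutionOne k V) :
    ∑ a : AllArrows V, ∑ p : AllPaths V,
      op (ψ.1 a (ofPath k p.2.2)) • resolutionOne.tensor (pathCoord k V p) a = ψ := by
  refine Subtype.ext (funext fun b => LinearMap.ext fun x => ?_)
  simp only [Submodule.coe_sum, Finset.sum_apply, LinearMap.sum_apply]
  rw [Finset.sum_eq_single b]
  · rw [← (ψ.2 b x).1, ← sum_pathCoord_smul (idem k b.2.1 * x), map_sum]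
    refine Finset.sum_congr rfl fun p _ => ?_
    rw [resolutionOne.smul_apply, tensor_apply_self, unop_op, smul_mul_assoc, (ψ.2 b _).2,
      map_smul]
  · intro a _ ha
    exact Finset.sum_eq_zero fun p _ => by
      rw [resolutionOne.smul_apply, tensor_apply_of_ne _ (Ne.symm ha), zero_mul]
  · simp

variable [Finite (AllPaths V)]

variable (k V) in
/-- The additive homomorphism onto `Ext¹(DA, A)`. -/
noncomputable def extMkHom : (resolutionOne k V →ₗ[(PathAlgebra k V)ᵐᵒᵖ] PathAlgebra k V) →+
    ExtDual.{u, max v w} k (PathAlgebra k V) 1 :=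
  AddMonoidHom.mk' extMk extMk_add

theorem extMkHom_apply (Θ : resolutionOne k V →ₗ[(PathAlgebra k V)ᵐᵒᵖ] PathAlgebra k V) :
    extMkHom k V Θ = extMk Θ := rfl

variable (k) in
/-- The generator of the bimodule `Ext¹(DA, A)` given by an arrow. -/
noncomputable def extArrow (a : AllArrows V) : ExtDual.{u, max v w} k (PathAlgebra k V) 1 :=
  extMk (evalOne a (idem k a.2.1))

theorem op_smul_extArrow (a : AllArrows V) (p : PathAlgebra k V) :
    op p • extArrow k a = extMk (evalOne a p) := by
  rw [extArrow, op_smul_extMk]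
  congr 1
  exact LinearMap.ext fun ψ => (ψ.2 a p).1

theorem idem_smul_extArrow (a : AllArrows V) : idem k a.1 • extArrow k a = extArrow k a := by
  rw [extArrow, smul_extMk]
  congr 1
  exact LinearMap.ext fun ψ => (ψ.2 a _).2

theorem op_idem_smul_extArrow (a : AllArrows V) :
    op (idem k a.2.1) • extArrow k a = extArrow k a :=
  op_smul_extArrow a _

/-- The arrows generate `Ext¹(DA, A)` as a bimodule: every homomorphism on the syzygy is a sum of
evaluations at paths followed by left multiplications, and these represent the elements `b a* p`. -/
theorem extDual_linearMap_ext {M : Type*} [AddCommGroup M] [Module k M]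
    {g g' : ExtDual.{u, max v w} k (PathAlgebra k V) 1 →ₗ[k] M}
    (h : ∀ (b p : PathAlgebra k V) (a : AllArrows V), g (b • op p • extArrow k a) = g' (b • op p • extArrow k a)) : g = g' := by
  have := Fintype.ofFinite (AllPaths V)
  refine LinearMap.ext fun x => ?_
  obtain ⟨Θ, rfl⟩ := extMk_surjective x
  have hΘ : Θ = ∑ a : AllArrows V, ∑ p : AllPaths V,
      mulLeftHom (Θ (resolutionOne.tensor (pathCoord k V p) a)) ∘ₗ
        evalOne a (ofPath k p.2.2) := by
    refine LinearMap.ext fun ψ => ?_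
    conv_lhs => rw [← resolutionOne.sum_smul_tensor ψ]
    simp only [map_sum, map_smul, LinearMap.sum_apply]
    rfl
  rw [hΘ, ← extMkHom_apply]
  simp only [map_sum, extMkHom_apply, ← smul_extMk, ← op_smul_extArrow, h]

/-- The difference of the two sides is represented by the differential followed by evaluation at
`eᵢ`, hence by a coboundary. The two halves of the commutator in the differential give the two sums.
-/
theorem sum_extArrow_eq (i : V) :
    ∑ j : V, ∑ a : i ⟶ j, op (arrow k a) • extArrow k ⟨i, j, a⟩ =
      ∑ j : V, ∑ a : j ⟶ i, arrow k a • extArrow k ⟨j, i, a⟩ := by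
  rw [← sub_eq_zero]
  simp_rw [op_smul_extArrow, extArrow, smul_extMk, ← extMkHom_apply, ← map_sum]
  rw [← map_sub, extMkHom_apply, extMk_eq_zero_iff]
  refine ⟨evalZero (idem k i), LinearMap.ext fun ψ => ?_⟩
  rw [LinearMap.comp_apply, evalZero_apply, resolutionD_apply, LinearMap.sub_apply,
    Finset.sum_sub_distrib]
  simp only [LinearMap.sum_apply, Fintype.sum_sigma]
  congr 1
  · rw [Finset.sum_eq_single i]
    · simp only [arrow_mul_idem]
      rfl
    · intro i' _ h
      simp only [arrow_mul_idem_of_ne k _ h, map_zero, Finset.sum_const_zero]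
    · simp
  · refine Finset.sum_congr rfl fun j _ => ?_
    rw [Finset.sum_eq_single i]
    · rfl
    · intro i' _ h
      refine Finset.sum_eq_zero fun a _ => ?_
      have := resolutionOne.apply_idem_mul_of_ne ψ ⟨j, i', a⟩ h 1
      rw [mul_one] at this
      rw [this, mul_zero]
    · simp

/-! ### The universal property of the bimodule `Ext¹(DA, A)` -/

section Universal

variable {C : Type*} [Ring C] [Algebra k C] (l r : PathAlgebra k V →ₗ[k] C)
  (hl : ∀ x y, l (x * y) = l x * l y) (hr : ∀ x y, r (x * y) = r x * r y)
  (s : AllArrows V → C)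
  (hls : ∀ a, l (idem k a.1) * s a = s a) (hsr : ∀ a, s a * r (idem k a.2.1) = s a)
  (rel : ∀ i : V, ∑ j : V, ∑ a : i ⟶ j, s ⟨i, j, a⟩ * r (arrow k a) =
    ∑ j : V, ∑ a : j ⟶ i, l (arrow k a) * s ⟨j, i, a⟩)

omit [Finite (AllPaths V)] in
/-- The map on homomorphisms that induces the homomorphism of bimodules `Ext¹(DA, A) → C` with
given values on the generators. -/
noncomputable def extLiftAux [Fintype (AllPaths V)]
    (Θ : resolutionOne k V →ₗ[(PathAlgebra k V)ᵐᵒᵖ] PathAlgebra k V) : C :=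
  ∑ a : AllArrows V, ∑ p : AllPaths V,
    l (resolutionOne.onTensor Θ a (pathCoord k V p)) * s a * r (ofPath k p.2.2)

variable [Fintype (AllPaths V)]

omit [Finite (AllPaths V)] in
theorem extLiftAux_add (Θ Θ' : resolutionOne k V →ₗ[(PathAlgebra k V)ᵐᵒᵖ] PathAlgebra k V) :
    extLiftAux l r s (Θ + Θ') = extLiftAux l r s Θ + extLiftAux l r s Θ' := by
  simp only [extLiftAux, resolutionOne.onTensor_apply, LinearMap.add_apply, map_add, add_mul,
    Finset.sum_add_distrib]

omit [Finite (AllPaths V)] in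
include hl in
theorem extLiftAux_mulLeftHom_comp (b : PathAlgebra k V)
    (Θ : resolutionOne k V →ₗ[(PathAlgebra k V)ᵐᵒᵖ] PathAlgebra k V) :
    extLiftAux l r s (mulLeftHom b ∘ₗ Θ) = l b * extLiftAux l r s Θ := by
  simp only [extLiftAux, resolutionOne.onTensor_apply, LinearMap.comp_apply, mulLeftHom_apply, hl,
    Finset.mul_sum, mul_assoc]

omit [Finite (AllPaths V)] in
include hr in
theorem extLiftAux_comp_leftMul (b : PathAlgebra k V)
    (Θ : resolutionOne k V →ₗ[(PathAlgebra k V)ᵐᵒᵖ] PathAlgebra k V) :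
    extLiftAux l r s (Θ ∘ₗ resolutionOne.leftMul k V b) = extLiftAux l r s Θ * r b := by
  simp only [extLiftAux, Finset.sum_mul]
  refine Finset.sum_congr rfl fun a _ => ?_
  have := sum_apply_pathCoord_comp_mul
    (LinearMap.mulRight k (s a) ∘ₗ l ∘ₗ resolutionOne.onTensor Θ a) r (LinearMap.mulRight k b)
  simp only [LinearMap.comp_apply, LinearMap.mulRight_apply, hr, ← mul_assoc] at this
  rw [← this]
  refine Finset.sum_congr rfl fun p _ => ?_
  rw [resolutionOne.onTensor_apply, resolutionOne.onTensor_apply, LinearMap.comp_apply,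
    resolutionOne.leftMul_tensor]

omit [Finite (AllPaths V)] in
include hl hr rel in
-- The relations suffice: in the differential of `p* ⊗ eᵢ`, the term `p* a ⊗ eᵢ` yields `sₐ r(a)`
-- after the dual basis identity moves `a` to the other factor, and the term `p* ⊗ a` yields `l(a)
-- sₐ`. Collected by vertices, these cancel by `rel`.
theorem extLiftAux_comp_resolutionD
    (Φ : resolutionZero k V →ₗ[(PathAlgebra k V)ᵐᵒᵖ] PathAlgebra k V) :
    extLiftAux l r s (Φ ∘ₗ resolutionD k V) = 0 := by
  have h1 : ∀ a : AllArrows V, ∑ p : AllPaths V,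
      l (Φ (resolutionZero.tensor
        (pathCoord k V p ∘ₗ LinearMap.mulLeft k (arrow k a.2.2)) a.1)) * s a * r (ofPath k p.2.2) =
      ∑ p : AllPaths V, l (Φ (resolutionZero.tensor (pathCoord k V p) a.1)) *
        (s a * r (arrow k a.2.2)) * r (ofPath k p.2.2) := by
    intro a
    have := sum_apply_pathCoord_comp_mul
      (LinearMap.mulRight k (s a) ∘ₗ l ∘ₗ resolutionZero.onTensor Φ a.1) r
      (LinearMap.mulLeft k (arrow k a.2.2))
    simp only [LinearMap.comp_apply, LinearMap.mulRight_apply, LinearMap.mulLeft_apply, hr,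
      resolutionZero.onTensor_apply] at this
    rw [this]
    simp only [mul_assoc]
  have h2 : ∀ a : AllArrows V, ∀ p : AllPaths V,
      l (Φ (op (arrow k a.2.2) • resolutionZero.tensor (pathCoord k V p) a.2.1)) * s a *
        r (ofPath k p.2.2) =
      l (Φ (resolutionZero.tensor (pathCoord k V p) a.2.1)) * (l (arrow k a.2.2) * s a) *
        r (ofPath k p.2.2) := by
    intro a p
    rw [map_smul, op_smul_eq_mul, hl]
    simp only [mul_assoc]
  simp only [extLiftAux, resolutionOne.onTensor_apply, LinearMap.comp_apply, resolutionD_tensor,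
    map_sub, sub_mul, Finset.sum_sub_distrib]
  rw [sub_eq_zero, Finset.sum_congr rfl fun a _ => h1 a,
    Finset.sum_congr rfl fun a _ => Finset.sum_congr rfl fun p _ => h2 a p, Finset.sum_comm,
    Finset.sum_comm (s := (Finset.univ : Finset (AllArrows V)))]
  refine Finset.sum_congr rfl fun p _ => ?_
  simp only [Fintype.sum_sigma]
  simp only [← Finset.sum_mul, ← Finset.mul_sum, rel]
  rw [Finset.sum_comm (f := fun i j => _)]
  simp only [← Finset.mul_sum]

omit [Finite (AllPaths V)] in
include hls hsr in
theorem extLiftAux_evalOne (a : AllArrows V) :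
    extLiftAux l r s (evalOne a (idem k a.2.1)) = s a := by
  rw [extLiftAux, Finset.sum_eq_single a]
  · have h : ∀ p : AllPaths V,
        l (resolutionOne.onTensor (evalOne a (idem k a.2.1)) a (pathCoord k V p)) * s a *
          r (ofPath k p.2.2) =
        s a * r (pathCoord k V p (idem k a.2.1) • ofPath k p.2.2) := by
      intro p
      rw [resolutionOne.onTensor_apply, evalOne_apply, resolutionOne.tensor_apply_self,
        idem_mul_idem, map_smul, smul_mul_assoc, hls, map_smul, smul_mul_assoc, mul_smul_comm]
    rw [Finset.sum_congr rfl fun p _ => h p, ← Finset.mul_sum, ← map_sum, sum_pathCoord_smul, hsr]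
  · intro b _ hb
    refine Finset.sum_eq_zero fun p _ => ?_
    rw [resolutionOne.onTensor_apply, evalOne_apply,
      resolutionOne.tensor_apply_of_ne _ (Ne.symm hb), map_zero, zero_mul, zero_mul]
  · simp

omit [Fintype (AllPaths V)] in
include hl hr hls hsr rel in
/-- The universal property of the bimodule `Ext¹(DA, A)`. -/
theorem exists_extLift : ∃ g : ExtDual.{u, max v w} k (PathAlgebra k V) 1 →ₗ[k] C,
    (∀ b x, g (b • x) = l b * g x) ∧ (∀ b x, g (op b • x) = g x * r b) ∧
      ∀ a, g (extArrow k a) = s a := by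
  have := Fintype.ofFinite (AllPaths V)
  let Γ : (resolutionOne k V →ₗ[(PathAlgebra k V)ᵐᵒᵖ] PathAlgebra k V) →+ C :=
    AddMonoidHom.mk' (extLiftAux l r s) (extLiftAux_add l r s)
  -- Coboundaries are killed, so the map descends along the surjection `extMkHom`.
  have hker : (extMkHom k V).ker ≤ Γ.ker := by
    intro Θ hΘ
    obtain ⟨Φ, rfl⟩ := (extMk_eq_zero_iff Θ).mp hΘ
    exact extLiftAux_comp_resolutionD l r hl hr s rel Φ
  let G := (extMkHom k V).liftOfSurjective extMk_surjective ⟨Γ, hker⟩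
  have hG : ∀ Θ, G (extMk Θ) = extLiftAux l r s Θ := fun Θ =>
    (extMkHom k V).liftOfRightInverse_comp_apply _ _ ⟨Γ, hker⟩ Θ
  have hleft : ∀ (b : PathAlgebra k V) x, G (b • x) = l b * G x := by
    intro b x
    obtain ⟨Θ, rfl⟩ := extMk_surjective x
    rw [smul_extMk, hG, hG, extLiftAux_mulLeftHom_comp l r hl]
  have hright : ∀ (b : PathAlgebra k V) x, G (op b • x) = G x * r b := by
    intro b x
    obtain ⟨Θ, rfl⟩ := extMk_surjective x
    rw [op_smul_extMk, hG, hG, extLiftAux_comp_leftMul l r hr]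
  refine ⟨{ toFun := G, map_add' := map_add G, map_smul' := fun c x => ?_ }, hleft, hright,
    fun a => (hG _).trans (extLiftAux_evalOne l r s hls hsr a)⟩
  -- Since `l` need not be unital, `l 1` is absorbed by reading it again as the action of `1`.
  rw [← ExtDual.algebraMap_smul_left, hleft, Algebra.algebraMap_eq_smul_one, map_smul,
    smul_mul_assoc, ← hleft, one_smul, RingHom.id_apply]

end Universal

end Presentation

end PathAlgebra

namespace PathAlgebra

variable {k : Type u} {V : Type v} [Field k] [Quiver.{w} V]

theorem map_mul_of_ofPath [Fintype V] {C : Type*} [Ring C] [Algebra k C]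
    (F : PathAlgebra k V →ₗ[k] C)
    (h : ∀ {i j i' j' : V} (p : Quiver.Path i j) (q : Quiver.Path i' j'),
      F (ofPath k p * ofPath k q) = F (ofPath k p) * F (ofPath k q)) (x y : PathAlgebra k V) :
    F (x * y) = F x * F y := by
  have key : F ∘ₗ LinearMap.mul k _ x = LinearMap.mul k _ (F x) ∘ₗ F := by
    apply linearMap_ext
    intro i' j' q
    have : F ∘ₗ (LinearMap.mul k _).flip (ofPath k q) =
        (LinearMap.mul k _).flip (F (ofPath k q)) ∘ₗ F := by
      apply linearMap_ext
      intro i j p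
      exact h p q
    exact LinearMap.congr_fun this x
  exact LinearMap.congr_fun key y

end PathAlgebra

/-! ### The copies of `A` inside the path algebra of the large quiver -/

section Layer

open PathAlgebra

variable (k : Type u) {V : Type v} [Field k] [Quiver.{w} V] {m : ℕ}

/-- The inclusion of the path algebra of the `l`-th copy. -/
noncomputable def layerMap (l : Fin (m + 1)) :
    PathAlgebra k V →ₗ[k] PathAlgebra k (HatVertex V m) :=
  (pathBasis k V).constr k fun p => hatPath k p.2.2 l

variable {k}

theorem layerMap_ofPath (l : Fin (m + 1)) {i j : V} (p : Quiver.Path i j) :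
    layerMap k l (ofPath k p) = hatPath k p l :=
  (pathBasis k V).constr_basis k _ ⟨i, j, p⟩

theorem layerMap_idem (l : Fin (m + 1)) (i : V) :
    layerMap k l (idem k i) = idem k (⟨i, l⟩ : HatVertex V m) :=
  layerMap_ofPath l _

theorem layerMap_arrow (l : Fin (m + 1)) {i j : V} (a : i ⟶ j) :
    layerMap k l (arrow k a) = hatCopy k a l :=
  layerMap_ofPath l _

theorem layerMap_mul [Fintype V] (l : Fin (m + 1)) (x y : PathAlgebra k V) :
    layerMap k l (x * y) = layerMap k l x * layerMap k l y := by
  refine map_mul_of_ofPath _ (fun {i j i' j'} p q => ?_) x y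
  by_cases h : i = j'
  · subst h
    rw [ofPath_mul_ofPath, layerMap_ofPath, layerMap_ofPath, layerMap_ofPath, hatPath, hatPath,
      hatPath, Prefunctor.mapPath_comp]
    exact (ofPath_mul_ofPath k _ _).symm
  · rw [ofPath_mul_ofPath_of_ne k _ _ h, map_zero, layerMap_ofPath, layerMap_ofPath]
    exact (ofPath_mul_ofPath_of_ne k _ _ fun h' => h (congrArg HatVertex.vertex h')).symm

/-- The unit of `A` becomes in each copy the idempotent of that copy, and the idempotents of
different copies are orthogonal. -/
theorem layerMap_mul_layerMap_of_ne [Fintype V] {l l' : Fin (m + 1)} (h : l ≠ l')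
    (x y : PathAlgebra k V) : layerMap k l x * layerMap k l' y = 0 := by
  rw [← mul_one x, ← one_mul y, layerMap_mul, layerMap_mul, mul_assoc,
    ← mul_assoc (layerMap k l 1), one_def, map_sum, map_sum, Finset.sum_mul_sum,
    Finset.sum_eq_zero, zero_mul, mul_zero]
  intro i _
  refine Finset.sum_eq_zero fun j _ => ?_
  rw [layerMap_idem, layerMap_idem]
  exact idem_mul_idem_of_ne k fun h' => h (congrArg HatVertex.copy h')

theorem sum_layerMap_one [Fintype V] :
    ∑ l, layerMap k l (1 : PathAlgebra k V) = (1 : PathAlgebra k (HatVertex V m)) := by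
  simp_rw [one_def, map_sum, layerMap_idem]
  rw [Finset.sum_comm, ← Fintype.sum_prod_type' fun i l => idem k (⟨i, l⟩ : HatVertex V m)]
  exact (Equiv.sum_comp (HatVertex.equivProd V m).symm fun x => idem k x)

end Layer

/-! ### Matrix units of the trivial extension algebra -/

section TrivialExtension

open MulOpposite PathAlgebra TrivSqZeroExt

variable (k : Type u) (A : Type (max u v)) [Field k] [Ring A] [Algebra k A] (d m : ℕ)

namespace CornerBimodule

variable {k A d m}

/-- The matrix with the given superdiagonal and corner entry. -/
def mk (x : Fin m → A) (y : ExtDual.{u, v} k A d) : CornerBimodule.{u, v} k A d m := (x, y)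

variable (k A d m) in
/-- The superdiagonal of a matrix. -/
def superdiagonal : CornerBimodule.{u, v} k A d m →ₗ[k] Fin m → A where
  toFun z := z.1
  map_add' _ _ := rfl
  map_smul' _ _ := rfl

variable (k A d m) in
/-- The corner entry of a matrix. -/
def cornerEntry : CornerBimodule.{u, v} k A d m →ₗ[k] ExtDual.{u, v} k A d where
  toFun z := z.2
  map_add' _ _ := rfl
  map_smul' _ _ := rfl

theorem mk_superdiagonal_cornerEntry (z : CornerBimodule.{u, v} k A d m) :
    mk (superdiagonal k A d m z) (cornerEntry k A d m z) = z := rfl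

theorem mk_add_mk (x x' : Fin m → A) (y y' : ExtDual.{u, v} k A d) :
    mk x y + mk x' y' = mk (x + x') (y + y') := rfl

theorem smul_mk (c : k) (x : Fin m → A) (y : ExtDual.{u, v} k A d) :
    c • mk x y = mk (c • x) (c • y) := rfl

theorem diagonal_smul_mk (r : DiagonalAlgebra A m) (x : Fin m → A) (y : ExtDual.{u, v} k A d) :
    r • mk x y = mk (fun l => r l.castSucc * x l) (r (Fin.last m) • y) := rfl

theorem op_diagonal_smul_mk (r : DiagonalAlgebra A m) (x : Fin m → A)
    (y : ExtDual.{u, v} k A d) :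
    op r • mk x y = mk (fun l => x l * r l.succ) (op (r 0) • y) := rfl

theorem superdiagonal_smul (r : DiagonalAlgebra A m) (z : CornerBimodule.{u, v} k A d m)
    (l : Fin m) :
    superdiagonal k A d m (r • z) l = r l.castSucc * superdiagonal k A d m z l := rfl

theorem superdiagonal_op_smul (r : DiagonalAlgebra A m) (z : CornerBimodule.{u, v} k A d m)
    (l : Fin m) :
    superdiagonal k A d m (op r • z) l = superdiagonal k A d m z l * r l.succ := rfl

theorem cornerEntry_smul (r : DiagonalAlgebra A m) (z : CornerBimodule.{u, v} k A d m) :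
    cornerEntry k A d m (r • z) = r (Fin.last m) • cornerEntry k A d m z := rfl

theorem cornerEntry_op_smul (r : DiagonalAlgebra A m) (z : CornerBimodule.{u, v} k A d m) :
    cornerEntry k A d m (op r • z) = op (r 0) • cornerEntry k A d m z := rfl

end CornerBimodule

namespace TrivialExtensionAlgebra

open CornerBimodule

variable {m}

/-- The diagonal entry `l`. -/
noncomputable def diag (l : Fin (m + 1)) : A →ₗ[k] TrivialExtensionAlgebra.{u, v} k A d m where
  toFun x := inl (Pi.single l x : DiagonalAlgebra A m)
  map_add' x y := by rw [Pi.single_add, inl_add]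
  map_smul' c x := by rw [Pi.single_smul, inl_smul, RingHom.id_apply]

/-- The superdiagonal entry in row `l`. -/
noncomputable def sup (l : Fin m) : A →ₗ[k] TrivialExtensionAlgebra.{u, v} k A d m where
  toFun x := inr (mk (Pi.single l x) 0)
  map_add' x y := by rw [← inr_add, mk_add_mk, Pi.single_add, add_zero]
  map_smul' c x := by rw [RingHom.id_apply, ← inr_smul, smul_mk, Pi.single_smul, smul_zero]

variable (m) in
/-- The corner entry. -/
noncomputable def corner :
    ExtDual.{u, v} k A d →ₗ[k] TrivialExtensionAlgebra.{u, v} k A d m where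
  toFun x := inr (mk 0 x)
  map_add' x y := by rw [← inr_add, mk_add_mk, add_zero]
  map_smul' c x := by rw [RingHom.id_apply, ← inr_smul, smul_mk, smul_zero]

variable {k A d}

theorem diag_apply (l : Fin (m + 1)) (x : A) :
    diag k A d l x = inl (Pi.single l x : DiagonalAlgebra A m) := rfl

theorem sup_apply (l : Fin m) (x : A) : sup k A d l x = inr (mk (Pi.single l x) 0) := rfl

theorem corner_apply (x : ExtDual.{u, v} k A d) : corner k A d m x = inr (mk 0 x) := rfl

theorem sum_diag (r : DiagonalAlgebra A m) : ∑ l, diag k A d l (r l) = inl r := by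
  simp_rw [diag_apply]
  rw [← inl_sum, Finset.univ_sum_single]

theorem sum_sup_add_corner (z : CornerBimodule.{u, v} k A d m) :
    ∑ l, sup k A d l (superdiagonal k A d m z l) + corner k A d m (cornerEntry k A d m z) =
      inr z := by
  simp_rw [sup_apply, corner_apply]
  rw [← inr_sum, ← inr_add]
  congr 1
  have h : ∀ s : Finset (Fin m), ∑ l ∈ s, mk (Pi.single l (superdiagonal k A d m z l)) 0 =
      (mk (∑ l ∈ s, Pi.single l (superdiagonal k A d m z l)) 0 :
        CornerBimodule.{u, v} k A d m) := by
    intro s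
    induction s using Finset.cons_induction with
    | empty => rfl
    | cons l s hl ih => rw [Finset.sum_cons, ih, Finset.sum_cons, mk_add_mk, add_zero]
  rw [h, Finset.univ_sum_single, mk_add_mk, add_zero, zero_add, mk_superdiagonal_cornerEntry]

theorem diag_mul_diag (l : Fin (m + 1)) (x y : A) :
    diag k A d l x * diag k A d l y = diag k A d l (x * y) := by
  rw [diag_apply, diag_apply, inl_mul_inl, diag_apply, ← Pi.single_mul]

theorem diag_mul_diag_of_ne {l l' : Fin (m + 1)} (h : l ≠ l') (x y : A) :
    diag k A d l x * diag k A d l' y = 0 := by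
  have h0 : (Pi.single l x * Pi.single l' y : DiagonalAlgebra A m) = 0 := by
    ext i
    by_cases hi : i = l
    · subst hi
      simp [h]
    · simp [hi]
  rw [diag_apply, diag_apply, inl_mul_inl, h0, inl_zero]

theorem diag_mul_sup (l : Fin m) (x y : A) :
    diag k A d l.castSucc x * sup k A d l y = sup k A d l (x * y) := by
  rw [diag_apply, sup_apply, inl_mul_inr, sup_apply, diagonal_smul_mk, smul_zero]
  congr 2
  ext l'
  by_cases h : l' = l
  · subst h
    simp
  · simp [h]

theorem sup_mul_diag (l : Fin m) (x y : A) :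
    sup k A d l x * diag k A d l.succ y = sup k A d l (x * y) := by
  rw [diag_apply, sup_apply, inr_mul_inl, sup_apply, op_diagonal_smul_mk, smul_zero]
  congr 2
  ext l'
  by_cases h : l' = l
  · subst h
    simp
  · simp [h]

theorem diag_last_mul_corner (x : A) (y : ExtDual.{u, v} k A d) :
    diag k A d (Fin.last m) x * corner k A d m y = corner k A d m (x • y) := by
  rw [diag_apply, corner_apply, inl_mul_inr, corner_apply, diagonal_smul_mk, Pi.single_eq_same]
  congr 2
  ext l
  exact mul_zero _

theorem corner_mul_diag_zero (x : A) (y : ExtDual.{u, v} k A d) :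
    corner k A d m y * diag k A d 0 x = corner k A d m (op x • y) := by
  rw [diag_apply, corner_apply, inr_mul_inl, corner_apply, op_diagonal_smul_mk,
    Pi.single_eq_same]
  congr 2
  ext l
  exact zero_mul _

theorem mul_eq_zero_of_fst {x y : TrivialExtensionAlgebra.{u, v} k A d m} (hx : x.fst = 0)
    (hy : y.fst = 0) : x * y = 0 := by
  rw [← inl_fst_add_inr_snd_eq x, ← inl_fst_add_inr_snd_eq y, hx, hy, inl_zero, zero_add, zero_add,
    inr_mul_inr]

theorem fst_sup (l : Fin m) (x : A) : (sup k A d l x).fst = 0 := rfl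

theorem fst_corner (x : ExtDual.{u, v} k A d) : (corner k A d m x).fst = 0 := rfl

end TrivialExtensionAlgebra

end TrivialExtension

/-! ### The homomorphism from the path algebra onto `B` -/

section HatMap

open MulOpposite PathAlgebra TrivialExtensionAlgebra

variable {k : Type u} {V : Type v} [Field k] [Quiver.{w} V] [Fintype V]
  [∀ i j : V, Fintype (i ⟶ j)] [Finite (AllPaths V)] {m : ℕ}

variable (k) in
/-- The element of the trivial extension algebra given by a vertex. -/
noncomputable def hatVertexValue (x : HatVertex V m) :
    TrivialExtensionAlgebra.{u, max v w} k (PathAlgebra k V) 1 m :=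
  diag k (PathAlgebra k V) 1 x.copy (idem k x.vertex)

variable (k) in
/-- The element of the trivial extension algebra given by an arrow. -/
noncomputable def hatArrowValue : ∀ {x y : HatVertex V m}, (x ⟶ y) →
    TrivialExtensionAlgebra.{u, max v w} k (PathAlgebra k V) 1 m
  | _, _, .copy a l => diag k (PathAlgebra k V) 1 l (arrow k a)
  | _, _, .down i l => sup k (PathAlgebra k V) 1 l (idem k i)
  | _, _, .star a => corner k (PathAlgebra k V) 1 m (extArrow k ⟨_, _, a⟩)

theorem hatVertexValue_mul_hatArrowValue {x y : HatVertex V m} (a : x ⟶ y) :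
    hatVertexValue k y * hatArrowValue k a = hatArrowValue k a := by
  change HatArrow V m x y at a
  cases a with
  | copy a l => exact (diag_mul_diag l _ _).trans (by rw [idem_mul_arrow]; rfl)
  | down i l => exact (diag_mul_sup l _ _).trans (by rw [idem_mul_idem]; rfl)
  | star a => exact (diag_last_mul_corner _ _).trans (by rw [idem_smul_extArrow ⟨_, _, a⟩]; rfl)

theorem hatArrowValue_mul_hatVertexValue {x y : HatVertex V m} (a : x ⟶ y) :
    hatArrowValue k a * hatVertexValue k x = hatArrowValue k a := by
  change HatArrow V m x y at a
  cases a with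
  | copy a l => exact (diag_mul_diag l _ _).trans (by rw [arrow_mul_idem]; rfl)
  | down i l => exact (sup_mul_diag l _ _).trans (by rw [idem_mul_idem]; rfl)
  | star a => exact (corner_mul_diag_zero _ _).trans (by rw [op_idem_smul_extArrow ⟨_, _, a⟩]; rfl)

omit [∀ i j : V, Fintype (i ⟶ j)] [Finite (AllPaths V)] in
theorem sum_diag_one : ∑ l, diag k (PathAlgebra k V) 1 l 1 =
    (1 : TrivialExtensionAlgebra.{u, max v w} k (PathAlgebra k V) 1 m) :=
  sum_diag 1

variable (k V m) in
/-- The homomorphism from the path algebra of the quiver to the trivial extension algebra. -/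
noncomputable def hatMap : PathAlgebra k (HatVertex V m) →ₐ[k]
    TrivialExtensionAlgebra.{u, max v w} k (PathAlgebra k V) 1 m :=
  PathAlgebra.lift (hatVertexValue k) (hatArrowValue k)
    (fun x => (diag_mul_diag _ _ _).trans (by rw [idem_mul_idem]; rfl))
    (fun x y h => by
      rw [hatVertexValue, hatVertexValue]
      by_cases hc : x.copy = y.copy
      · rw [hc, diag_mul_diag, idem_mul_idem_of_ne k fun hv => h (HatVertex.ext hv hc), map_zero]
      · exact diag_mul_diag_of_ne hc _ _)
    hatVertexValue_mul_hatArrowValue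
    (by
      rw [← sum_diag_one]
      simp_rw [one_def, map_sum]
      rw [Finset.sum_comm, ← Fintype.sum_prod_type' fun i l => diag k (PathAlgebra k V) 1 l (idem k i)]
      exact (Equiv.sum_comp (HatVertex.equivProd V m).symm fun x => hatVertexValue k x).symm)

theorem hatMap_idem (x : HatVertex V m) : hatMap k V m (idem k x) = hatVertexValue k x :=
  lift_idem _ _ _ _ _ _ _

theorem hatMap_arrow {x y : HatVertex V m} (a : x ⟶ y) :
    hatMap k V m (arrow k a) = hatArrowValue k a :=
  lift_arrow _ _ _ _ _ _ _ (hatArrowValue_mul_hatVertexValue a)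

theorem hatMap_hatCopy {i j : V} (a : i ⟶ j) (l : Fin (m + 1)) :
    hatMap k V m (hatCopy k a l) = diag k (PathAlgebra k V) 1 l (arrow k a) :=
  hatMap_arrow _

theorem hatMap_hatDown (i : V) (l : Fin m) :
    hatMap k V m (hatDown k i l) = sup k (PathAlgebra k V) 1 l (idem k i) :=
  hatMap_arrow _

theorem hatMap_hatStar {i j : V} (a : i ⟶ j) :
    hatMap k V m (hatStar k m a) = corner k (PathAlgebra k V) 1 m (extArrow k ⟨i, j, a⟩) :=
  hatMap_arrow _

theorem hatMap_layerMap (l : Fin (m + 1)) (x : PathAlgebra k V) :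
    hatMap k V m (layerMap k l x) = diag k (PathAlgebra k V) 1 l x := by
  have : (hatMap k V m).toLinearMap ∘ₗ layerMap k l = diag k (PathAlgebra k V) 1 l := by
    apply linearMap_ext
    intro i j p
    rw [LinearMap.comp_apply, AlgHom.toLinearMap_apply]
    induction p with
    | nil =>
      refine Eq.trans ?_ (hatMap_idem (⟨i, l⟩ : HatVertex V m))
      rw [← layerMap_idem]
      rfl
    | cons p a ih =>
      rw [ofPath_cons, layerMap_mul, map_mul, ih, layerMap_arrow, hatMap_hatCopy, diag_mul_diag]
  exact LinearMap.congr_fun this x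

/-- The second relation is the one in `Ext¹(DA, A)`. The monomial relations hold because they
multiply two elements of the square-zero ideal. -/
theorem hatMap_eq_zero_of_hatRelation {x : PathAlgebra k (HatVertex V m)}
    (hx : HatRelation k V m x) : hatMap k V m x = 0 := by
  cases hx with
  | comm a l =>
    rw [map_sub, map_mul, map_mul, hatMap_hatCopy, hatMap_hatCopy, hatMap_hatDown, hatMap_hatDown,
      diag_mul_sup, sup_mul_diag, arrow_mul_idem, idem_mul_arrow, sub_self]
  | preprojective i =>
    simp only [map_sub, map_sum, map_mul, hatMap_hatCopy, hatMap_hatStar, corner_mul_diag_zero,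
      diag_last_mul_corner]
    simp only [← map_sum, sum_extArrow_eq, sub_self]
  | down_down i l l' h =>
    rw [map_mul, hatMap_hatDown, hatMap_hatDown]
    exact mul_eq_zero_of_fst (fst_sup _ _) (fst_sup _ _)
  | star_down a l h =>
    rw [map_mul, hatMap_hatDown, hatMap_hatStar]
    exact mul_eq_zero_of_fst (fst_corner _) (fst_sup _ _)
  | down_star a l h =>
    rw [map_mul, hatMap_hatDown, hatMap_hatStar]
    exact mul_eq_zero_of_fst (fst_sup _ _) (fst_corner _)
  | star_path_star hm a p c =>
    subst hm
    rw [map_mul, map_mul, hatMap_hatStar, hatMap_hatStar, ← layerMap_ofPath, hatMap_layerMap,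
      corner_mul_diag_zero]
    exact mul_eq_zero_of_fst (fst_corner _) (fst_corner _)

theorem hatMap_eq_zero_of_mem {x : PathAlgebra k (HatVertex V m)} (hx : x ∈ hatIdeal k V m) :
    hatMap k V m x = 0 := by
  have h : hatIdeal k V m ≤ TwoSidedIdeal.ker (hatMap k V m) :=
    TwoSidedIdeal.span_le.mpr fun y hy =>
      (TwoSidedIdeal.mem_ker _).mpr (hatMap_eq_zero_of_hatRelation hy)
  exact (TwoSidedIdeal.mem_ker _).mp (h hx)

/-- A path with image nonzero has at most one arrow that does not come from a copy of `Q`. -/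
theorem hatMap_ofPath {x y : HatVertex V m} (p : Quiver.Path x y) :
    hatMap k V m (ofPath k p) = 0 ∨
      (∃ q : Quiver.Path x.vertex y.vertex, q.length = p.length) ∨
      ((hatMap k V m (ofPath k p)).fst = 0 ∧ ∃ (i j : V) (q : Quiver.Path x.vertex i)
        (q' : Quiver.Path j y.vertex), p.length = q.length + 1 + q'.length) := by
  induction p with
  | nil => exact .inr (.inl ⟨.nil, rfl⟩)
  | @cons y z p a ih =>
    -- Once a path has left the copies of `Q` its image stays in the square-zero ideal, so a second
    -- departure kills it.
    have hfst : ∀ b : TrivialExtensionAlgebra.{u, max v w} k (PathAlgebra k V) 1 m,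
        (hatMap k V m (ofPath k p)).fst = 0 → (b * hatMap k V m (ofPath k p)).fst = 0 := by
      intro b hb
      rw [TrivSqZeroExt.fst_mul, hb, mul_zero]
    rw [ofPath_cons, map_mul, hatMap_arrow]
    change HatArrow V m y z at a
    rcases ih with h | ⟨q, hq⟩ | ⟨h, i, j, q, q', hq⟩
    · exact .inl (by rw [h, mul_zero])
    · cases a with
      | copy a l => exact .inr (.inl ⟨q.cons a, congrArg (· + 1) hq⟩)
      | down i l =>
        refine .inr (.inr ⟨?_, _, _, q, .nil, congrArg (· + 1) hq.symm⟩)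
        rw [TrivSqZeroExt.fst_mul]
        exact zero_mul _
      | @star i j a =>
        refine .inr (.inr ⟨?_, _, _, q, .nil, congrArg (· + 1) hq.symm⟩)
        rw [TrivSqZeroExt.fst_mul]
        exact zero_mul _
    · cases a with
      | copy a l => exact .inr (.inr ⟨hfst _ h, i, j, q, q'.cons a, congrArg (· + 1) hq⟩)
      | down i l => exact .inl (mul_eq_zero_of_fst (fst_sup _ _) h)
      | star a => exact .inl (mul_eq_zero_of_fst (fst_corner _) h)

end HatMap

section HatArrows

open PathAlgebra

variable {k : Type u} {V : Type v} [Field k] [Quiver.{w} V] {m : ℕ}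

theorem idem_mul_hatDown (i : V) (l : Fin m) :
    layerMap k l.castSucc (idem k i) * hatDown k i l = hatDown k i l := by
  rw [layerMap_idem]
  exact idem_mul_arrow k _

theorem idem_mul_hatDown_of_ne [Fintype V] {i j : V} (h : i ≠ j) (l : Fin m) :
    layerMap k l.castSucc (idem k i) * hatDown k j l = 0 := by
  rw [layerMap_idem]
  exact idem_mul_arrow_of_ne k _ fun h' => h (congrArg HatVertex.vertex h')

theorem hatDown_mul_idem (i : V) (l : Fin m) :
    hatDown k i l * layerMap k l.succ (idem k i) = hatDown k i l := by
  rw [layerMap_idem]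
  exact arrow_mul_idem k _

theorem hatDown_mul_idem_of_ne [Fintype V] {i j : V} (h : i ≠ j) (l : Fin m) :
    hatDown k i l * layerMap k l.succ (idem k j) = 0 := by
  rw [layerMap_idem]
  exact arrow_mul_idem_of_ne k _ fun h' => h (congrArg HatVertex.vertex h')

theorem idem_mul_hatStar {i j : V} (a : i ⟶ j) :
    layerMap k (Fin.last m) (idem k i) * hatStar k m a = hatStar k m a := by
  rw [layerMap_idem]
  exact idem_mul_arrow k _

theorem hatStar_mul_idem {i j : V} (a : i ⟶ j) :
    hatStar k m a * layerMap k 0 (idem k j) = hatStar k m a := by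
  rw [layerMap_idem]
  exact arrow_mul_idem k _

end HatArrows

/-! ### The relations of `B` in the quotient by `I` -/

section HatQuotient

open MulOpposite PathAlgebra

variable (k : Type u) (V : Type v) [Field k] [Quiver.{w} V] [Fintype V]
  [∀ i j : V, Fintype (i ⟶ j)] (m : ℕ)

/-- The algebra presented by the quiver with relations. -/
abbrev HatQuotient : Type (max u v w) := (hatIdeal k V m).ringCon.Quotient

/-- The quotient map. -/
noncomputable def hatMk : PathAlgebra k (HatVertex V m) →ₐ[k] HatQuotient k V m :=
  RingCon.mkₐ k _

variable {k V m}

theorem hatMk_eq_zero_iff {x : PathAlgebra k (HatVertex V m)} :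
    hatMk k V m x = 0 ↔ x ∈ hatIdeal k V m :=
  (RingCon.eq _).trans (TwoSidedIdeal.mem_iff _ _).symm

theorem hatMk_surjective : Function.Surjective (hatMk k V m) := Quotient.mk''_surjective

theorem hatMk_eq_zero_of_hatRelation {x : PathAlgebra k (HatVertex V m)}
    (hx : HatRelation k V m x) : hatMk k V m x = 0 :=
  hatMk_eq_zero_iff.mpr (TwoSidedIdeal.subset_span hx)

variable (k V m) in
/-- The `l`-th copy of the path algebra in the quotient. -/
noncomputable def hatLayerMk (l : Fin (m + 1)) : PathAlgebra k V →ₗ[k] HatQuotient k V m :=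
  (hatMk k V m).toLinearMap ∘ₗ layerMap k l

variable (k V) in
/-- The sum of the arrows from one copy to the next. -/
noncomputable def hatDownMk (l : Fin m) : HatQuotient k V m := ∑ i : V, hatMk k V m (hatDown k i l)

variable (k V m) in
/-- The arrow `a*` in the quotient. -/
noncomputable def hatStarMk (a : AllArrows V) : HatQuotient k V m :=
  hatMk k V m (hatStar k m a.2.2)

theorem hatLayerMk_apply (l : Fin (m + 1)) (x : PathAlgebra k V) :
    hatLayerMk k V m l x = hatMk k V m (layerMap k l x) := rfl

theorem hatLayerMk_mul (l : Fin (m + 1)) (x y : PathAlgebra k V) :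
    hatLayerMk k V m l (x * y) = hatLayerMk k V m l x * hatLayerMk k V m l y := by
  rw [hatLayerMk_apply, layerMap_mul, map_mul]
  rfl

theorem hatLayerMk_mul_of_ne {l l' : Fin (m + 1)} (h : l ≠ l') (x y : PathAlgebra k V) :
    hatLayerMk k V m l x * hatLayerMk k V m l' y = 0 := by
  rw [hatLayerMk_apply, hatLayerMk_apply, ← map_mul, layerMap_mul_layerMap_of_ne h, map_zero]

theorem sum_hatLayerMk_one : ∑ l, hatLayerMk k V m l 1 = 1 := by
  simp_rw [hatLayerMk_apply]
  rw [← map_sum, sum_layerMap_one, map_one]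

theorem hatLayerMk_idem_mul_hatDownMk (i : V) (l : Fin m) :
    hatLayerMk k V m l.castSucc (idem k i) * hatDownMk k V l = hatMk k V m (hatDown k i l) := by
  rw [hatDownMk, Finset.mul_sum, Finset.sum_eq_single i]
  · rw [hatLayerMk_apply, ← map_mul, idem_mul_hatDown]
  · intro j _ h
    rw [hatLayerMk_apply, ← map_mul, idem_mul_hatDown_of_ne (Ne.symm h), map_zero]
  · simp

theorem hatDownMk_mul_hatLayerMk_idem (i : V) (l : Fin m) :
    hatDownMk k V l * hatLayerMk k V m l.succ (idem k i) = hatMk k V m (hatDown k i l) := by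
  rw [hatDownMk, Finset.sum_mul, Finset.sum_eq_single i]
  · rw [hatLayerMk_apply, ← map_mul, hatDown_mul_idem]
  · intro j _ h
    rw [hatLayerMk_apply, ← map_mul, hatDown_mul_idem_of_ne h, map_zero]
  · simp

theorem hatLayerMk_arrow_mul_hatDown {i j : V} (a : i ⟶ j) (l : Fin m) :
    hatLayerMk k V m l.castSucc (arrow k a) * hatMk k V m (hatDown k i l) =
      hatMk k V m (hatDown k j l) * hatLayerMk k V m l.succ (arrow k a) := by
  have := hatMk_eq_zero_of_hatRelation (HatRelation.comm (k := k) a l)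
  rwa [map_sub, sub_eq_zero, map_mul, map_mul, ← layerMap_arrow, ← layerMap_arrow] at this

/-- The commutation relations for arrows extend along paths to all of `A`. Thus the sum of the `vᵢˡ`
generates an image of the bimodule `A`, as a superdiagonal entry requires. -/
theorem hatDownMk_mul_hatLayerMk (l : Fin m) (x : PathAlgebra k V) :
    hatDownMk k V l * hatLayerMk k V m l.succ x =
      hatLayerMk k V m l.castSucc x * hatDownMk k V l := by
  have : LinearMap.mulLeft k (hatDownMk k V l) ∘ₗ hatLayerMk k V m l.succ =
      LinearMap.mulRight k (hatDownMk k V l) ∘ₗ hatLayerMk k V m l.castSucc := by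
    apply linearMap_ext
    intro i j p
    simp only [LinearMap.comp_apply, LinearMap.mulLeft_apply, LinearMap.mulRight_apply]
    induction p with
    | nil =>
      exact (hatDownMk_mul_hatLayerMk_idem i l).trans (hatLayerMk_idem_mul_hatDownMk i l).symm
    | @cons j j' p a ih =>
      rw [ofPath_cons, hatLayerMk_mul, hatLayerMk_mul, mul_assoc, ← ih, ← mul_assoc, ← mul_assoc]
      congr 1
      -- Inserting the idempotent at the target of `a` singles out one summand of `hatDownMk`; after
      -- the relation is applied, the idempotent at the source restores the full sum.
      rw [← idem_mul_arrow k a, hatLayerMk_mul, ← mul_assoc, hatDownMk_mul_hatLayerMk_idem,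
        ← hatLayerMk_arrow_mul_hatDown, idem_mul_arrow, ← hatLayerMk_idem_mul_hatDownMk,
        ← mul_assoc, ← hatLayerMk_mul, arrow_mul_idem]
  exact LinearMap.congr_fun this x

theorem hatLayerMk_one_mul_hatDownMk (l : Fin m) :
    hatLayerMk k V m l.castSucc 1 * hatDownMk k V l = hatDownMk k V l := by
  rw [one_def, map_sum, Finset.sum_mul, hatDownMk]
  exact Finset.sum_congr rfl fun i _ => hatLayerMk_idem_mul_hatDownMk i l

theorem hatDownMk_mul_hatLayerMk_one (l : Fin m) :
    hatDownMk k V l * hatLayerMk k V m l.succ 1 = hatDownMk k V l := by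
  rw [hatDownMk_mul_hatLayerMk, hatLayerMk_one_mul_hatDownMk]

theorem hatDownMk_mul_hatLayerMk_of_ne {l : Fin m} {l' : Fin (m + 1)} (h : l.succ ≠ l')
    (x : PathAlgebra k V) : hatDownMk k V l * hatLayerMk k V m l' x = 0 := by
  rw [← hatDownMk_mul_hatLayerMk_one, mul_assoc, hatLayerMk_mul_of_ne h, mul_zero]

/-- A relation is needed only for consecutive copies; in all other cases the arrows do not compose.
-/
theorem hatDownMk_mul_hatDownMk (l l' : Fin m) : hatDownMk k V l * hatDownMk k V l' = 0 := by
  rw [← hatLayerMk_one_mul_hatDownMk l']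
  by_cases h : l.succ = l'.castSucc
  · rw [one_def, map_sum, Finset.sum_mul, Finset.mul_sum]
    refine Finset.sum_eq_zero fun i _ => ?_
    rw [← idem_mul_idem, hatLayerMk_mul, mul_assoc, hatLayerMk_idem_mul_hatDownMk, ← mul_assoc,
      ← h, hatDownMk_mul_hatLayerMk_idem, ← map_mul]
    exact hatMk_eq_zero_of_hatRelation (HatRelation.down_down i l' l (congrArg Fin.val h))
  · rw [← mul_assoc, hatDownMk_mul_hatLayerMk_of_ne h, zero_mul]

theorem hatLayerMk_idem_mul_hatStarMk (a : AllArrows V) :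
    hatLayerMk k V m (Fin.last m) (idem k a.1) * hatStarMk k V m a = hatStarMk k V m a := by
  rw [hatLayerMk_apply, hatStarMk, ← map_mul, idem_mul_hatStar]

theorem hatStarMk_mul_hatLayerMk_idem (a : AllArrows V) :
    hatStarMk k V m a * hatLayerMk k V m 0 (idem k a.2.1) = hatStarMk k V m a := by
  rw [hatLayerMk_apply, hatStarMk, ← map_mul, hatStar_mul_idem]

theorem sum_hatStarMk_eq (i : V) :
    ∑ j : V, ∑ a : i ⟶ j, hatStarMk k V m ⟨i, j, a⟩ * hatLayerMk k V m 0 (arrow k a) =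
      ∑ j : V, ∑ a : j ⟶ i, hatLayerMk k V m (Fin.last m) (arrow k a) *
        hatStarMk k V m ⟨j, i, a⟩ := by
  have := hatMk_eq_zero_of_hatRelation (HatRelation.preprojective (k := k) (m := m) i)
  rw [map_sub, sub_eq_zero] at this
  simp only [map_sum, map_mul] at this
  simpa only [hatStarMk, hatLayerMk_apply, layerMap_arrow] using this

theorem hatDownMk_mul_hatStarMk (l : Fin m) (a : AllArrows V) :
    hatDownMk k V l * hatStarMk k V m a = 0 := by
  rw [← hatLayerMk_idem_mul_hatStarMk, ← mul_assoc]
  by_cases h : l.succ = Fin.last m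
  · rw [← h, hatDownMk_mul_hatLayerMk_idem, hatStarMk, ← map_mul]
    exact hatMk_eq_zero_of_hatRelation (HatRelation.down_star a.2.2 l (congrArg Fin.val h))
  · rw [hatDownMk_mul_hatLayerMk_of_ne h, zero_mul]

theorem hatStarMk_mul_hatDownMk (l : Fin m) (a : AllArrows V) :
    hatStarMk k V m a * hatDownMk k V l = 0 := by
  rw [← hatStarMk_mul_hatLayerMk_idem, mul_assoc]
  by_cases h : 0 = l.castSucc
  · rw [h, hatLayerMk_idem_mul_hatDownMk, hatStarMk, ← map_mul]
    exact hatMk_eq_zero_of_hatRelation (HatRelation.star_down a.2.2 l (congrArg Fin.val h).symm)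
  · rw [← hatLayerMk_one_mul_hatDownMk, ← mul_assoc (hatLayerMk k V m 0 _),
      hatLayerMk_mul_of_ne h, zero_mul, mul_zero]

/-- For `n = 1` this is the linear extension of the last relation. For `n ≥ 2` it holds without any
relation, because the first and the last copy have orthogonal idempotents. -/
theorem hatStarMk_mul_hatLayerMk_mul_hatStarMk (a c : AllArrows V) (x : PathAlgebra k V) :
    hatStarMk k V m a * hatLayerMk k V m 0 x * hatStarMk k V m c = 0 := by
  rw [← hatLayerMk_idem_mul_hatStarMk c, ← hatStarMk_mul_hatLayerMk_idem a]
  by_cases hm : m = 0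
  · subst hm
    have h0 : Fin.last 0 = 0 := rfl
    rw [h0]
    have : LinearMap.mulRight k (hatLayerMk k V 0 0 (idem k c.1) * hatStarMk k V 0 c) ∘ₗ
        LinearMap.mulLeft k (hatStarMk k V 0 a * hatLayerMk k V 0 0 (idem k a.2.1)) ∘ₗ
          hatLayerMk k V 0 0 = 0 := by
      apply linearMap_ext
      intro i j p
      simp only [LinearMap.comp_apply, LinearMap.mulLeft_apply, LinearMap.mulRight_apply,
        LinearMap.zero_apply]
      by_cases hj : a.2.1 = j
      · by_cases hi : i = c.1
        · obtain ⟨i', j', a⟩ := a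
          obtain ⟨i'', j'', c⟩ := c
          subst hi
          subst hj
          have := hatMk_eq_zero_of_hatRelation (HatRelation.star_path_star (k := k) rfl a p c)
          rw [map_mul, map_mul, ← layerMap_ofPath] at this
          rw [hatStarMk_mul_hatLayerMk_idem, ← h0, hatLayerMk_idem_mul_hatStarMk]
          exact this
        · rw [mul_assoc, ← mul_assoc (hatLayerMk k V 0 0 (ofPath k p)), ← hatLayerMk_mul,
            ofPath_mul_idem_of_ne k p hi, map_zero, zero_mul, mul_zero]
      · rw [mul_assoc (hatStarMk k V 0 a), ← hatLayerMk_mul, idem_mul_ofPath_of_ne k p hj,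
          map_zero, mul_zero, zero_mul]
    exact LinearMap.congr_fun this x
  · have h0 : (0 : Fin (m + 1)) ≠ Fin.last m := fun h => hm (congrArg Fin.val h).symm
    rw [mul_assoc, ← mul_assoc (hatLayerMk k V m 0 x), hatLayerMk_mul_of_ne h0, zero_mul, mul_zero]

end HatQuotient

/-! ### The isomorphism with `B` and the admissibility of `I` -/

section Isomorphism

open MulOpposite PathAlgebra TrivialExtensionAlgebra CornerBimodule

variable (k : Type u) (V : Type v) [Field k] [Quiver.{w} V] [Fintype V]
  [∀ i j : V, Fintype (i ⟶ j)] (m : ℕ)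

/-- The homomorphism from the diagonal matrices to the quotient. -/
noncomputable def diagonalToHat : DiagonalAlgebra (PathAlgebra k V) m →ₐ[k] HatQuotient k V m :=
  AlgHom.ofLinearMap (∑ l, hatLayerMk k V m l ∘ₗ LinearMap.proj l)
    (by
      rw [LinearMap.sum_apply]
      exact sum_hatLayerMk_one)
    (fun r s => by
      simp only [LinearMap.sum_apply, LinearMap.comp_apply, LinearMap.proj_apply, Pi.mul_apply,
        Finset.sum_mul]
      refine Finset.sum_congr rfl fun l _ => ?_
      rw [Finset.mul_sum, Finset.sum_eq_single l, hatLayerMk_mul]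
      · intro l' _ h
        exact hatLayerMk_mul_of_ne (Ne.symm h) _ _
      · simp)

variable {k V m}

theorem diagonalToHat_apply (r : DiagonalAlgebra (PathAlgebra k V) m) :
    diagonalToHat k V m r = ∑ l, hatLayerMk k V m l (r l) := by
  simp [diagonalToHat, LinearMap.sum_apply]

theorem diagonalToHat_single (l : Fin (m + 1)) (x : PathAlgebra k V) :
    diagonalToHat k V m (Pi.single l x) = hatLayerMk k V m l x := by
  rw [diagonalToHat_apply, Finset.sum_eq_single l, Pi.single_eq_same]
  · intro l' _ h
    rw [Pi.single_eq_of_ne h, map_zero]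
  · simp

theorem diagonalToHat_mul_hatLayerMk (r : DiagonalAlgebra (PathAlgebra k V) m) (l : Fin (m + 1))
    (x : PathAlgebra k V) :
    diagonalToHat k V m r * hatLayerMk k V m l x = hatLayerMk k V m l (r l * x) := by
  rw [diagonalToHat_apply, Finset.sum_mul, Finset.sum_eq_single l, hatLayerMk_mul]
  · intro l' _ h
    exact hatLayerMk_mul_of_ne h _ _
  · simp

theorem hatLayerMk_mul_diagonalToHat (r : DiagonalAlgebra (PathAlgebra k V) m) (l : Fin (m + 1))
    (x : PathAlgebra k V) :
    hatLayerMk k V m l x * diagonalToHat k V m r = hatLayerMk k V m l (x * r l) := by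
  rw [diagonalToHat_apply, Finset.mul_sum, Finset.sum_eq_single l, hatLayerMk_mul]
  · intro l' _ h
    exact hatLayerMk_mul_of_ne (Ne.symm h) _ _
  · simp

variable [Finite (AllPaths V)]

set_option maxHeartbeats 600000 in
/-- There is a homomorphism from the trivial extension algebra to the quotient that sends the
images of the generators to the generators. -/
theorem exists_trivialExtension_hom :
    ∃ G : TrivialExtensionAlgebra.{u, max v w} k (PathAlgebra k V) 1 m →ₐ[k] HatQuotient k V m,
      (∀ l x, G (diag k (PathAlgebra k V) 1 l x) = hatLayerMk k V m l x) ∧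
      (∀ l x, G (sup k (PathAlgebra k V) 1 l x) =
        hatLayerMk k V m l.castSucc x * hatDownMk k V l) ∧
      ∀ a, G (corner k (PathAlgebra k V) 1 m (extArrow k a)) = hatStarMk k V m a := by
  -- The corner has row `n` and column `1`, so `A` acts on the left through the last copy and on the
  -- right through the first. Neither inclusion need preserve the unit.
  obtain ⟨g, hgl, hgr, hga⟩ := exists_extLift (hatLayerMk k V m (Fin.last m)) (hatLayerMk k V m 0)
    (hatLayerMk_mul _) (hatLayerMk_mul _) (hatStarMk k V m) hatLayerMk_idem_mul_hatStarMk
    hatStarMk_mul_hatLayerMk_idem sum_hatStarMk_eq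
  have hgl1 : ∀ x, hatLayerMk k V m (Fin.last m) 1 * g x = g x := fun x => by
    rw [← hgl, one_smul]
  have hgr1 : ∀ x, g x * hatLayerMk k V m 0 1 = g x := fun x => by
    rw [← hgr, op_one, one_smul]
  have hvg : ∀ l x, hatDownMk k V l * g x = 0 := by
    intro l x
    have : LinearMap.mulLeft k (hatDownMk k V l) ∘ₗ g = 0 := by
      refine extDual_linearMap_ext fun b p a => ?_
      rw [LinearMap.comp_apply, LinearMap.mulLeft_apply, hgl, hgr, hga, LinearMap.zero_apply]
      by_cases h : l.succ = Fin.last m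
      · rw [← h, ← mul_assoc, hatDownMk_mul_hatLayerMk, mul_assoc, ← mul_assoc (hatDownMk k V l),
          hatDownMk_mul_hatStarMk, zero_mul, mul_zero]
      · rw [← mul_assoc, hatDownMk_mul_hatLayerMk_of_ne h, zero_mul]
    exact LinearMap.congr_fun this x
  have hgv : ∀ l x y, g x * (hatLayerMk k V m l.castSucc y * hatDownMk k V l) = 0 := by
    intro l x y
    by_cases h : 0 = l.castSucc
    · rw [← hatDownMk_mul_hatLayerMk, ← mul_assoc]
      have : LinearMap.mulRight k (hatDownMk k V l) ∘ₗ g = 0 := by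
        refine extDual_linearMap_ext fun b p a => ?_
        rw [LinearMap.comp_apply, LinearMap.mulRight_apply, hgl, hgr, hga, LinearMap.zero_apply,
          mul_assoc, mul_assoc, h, ← hatDownMk_mul_hatLayerMk, ← mul_assoc (hatStarMk k V m a),
          hatStarMk_mul_hatDownMk, zero_mul, mul_zero]
      have := LinearMap.congr_fun this x
      rw [LinearMap.comp_apply, LinearMap.mulRight_apply, LinearMap.zero_apply] at this
      rw [this, zero_mul]
    · rw [← hgr1, mul_assoc, ← mul_assoc (hatLayerMk k V m 0 1), hatLayerMk_mul_of_ne h, zero_mul,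
        mul_zero]
  -- Checking on generators in both variables reduces this to products `a* x c*` with `x` in `A`.
  have hgg : ∀ x y, g x * g y = 0 := by
    intro x y
    have h1 : LinearMap.mulRight k (g y) ∘ₗ g = 0 := by
      refine extDual_linearMap_ext fun b p a => ?_
      rw [LinearMap.comp_apply, LinearMap.mulRight_apply, hgl, hgr, hga, LinearMap.zero_apply]
      have h2 : LinearMap.mulLeft k (hatLayerMk k V m (Fin.last m) b *
          (hatStarMk k V m a * hatLayerMk k V m 0 p)) ∘ₗ g = 0 := by
        refine extDual_linearMap_ext fun b' p' a' => ?_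
        have h3 : hatStarMk k V m a * (hatLayerMk k V m 0 p * hatLayerMk k V m (Fin.last m) b') *
            hatStarMk k V m a' = 0 := by
          by_cases h : 0 = Fin.last m
          · rw [← h, ← hatLayerMk_mul, hatStarMk_mul_hatLayerMk_mul_hatStarMk]
          · rw [hatLayerMk_mul_of_ne h, mul_zero, zero_mul]
        simp only [mul_assoc] at h3
        rw [LinearMap.comp_apply, LinearMap.mulLeft_apply, hgl, hgr, hga, LinearMap.zero_apply]
        simp only [mul_assoc]
        have h4 : hatLayerMk k V m (Fin.last m) b * (hatStarMk k V m a * (hatLayerMk k V m 0 p *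
            (hatLayerMk k V m (Fin.last m) b' * hatStarMk k V m a'))) *
              hatLayerMk k V m 0 p' = 0 := by rw [h3, mul_zero, zero_mul]
        simpa only [mul_assoc] using h4
      exact LinearMap.congr_fun h2 y
    exact LinearMap.congr_fun h1 x
  let γ : CornerBimodule.{u, max v w} k (PathAlgebra k V) 1 m →ₗ[k] HatQuotient k V m :=
    (∑ l, LinearMap.mulRight k (hatDownMk k V l) ∘ₗ hatLayerMk k V m l.castSucc ∘ₗ
      LinearMap.proj l) ∘ₗ superdiagonal k (PathAlgebra k V) 1 m +
      g ∘ₗ cornerEntry k (PathAlgebra k V) 1 m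
  have hγ : ∀ z, γ z = ∑ l, hatLayerMk k V m l.castSucc
      (superdiagonal k (PathAlgebra k V) 1 m z l) * hatDownMk k V l +
      g (cornerEntry k (PathAlgebra k V) 1 m z) := by
    intro z
    simp [γ]
  -- The lift requires that products of values of `γ` vanish and that `γ` respects the two actions
  -- of the diagonal matrices.
  let G := TrivSqZeroExt.lift (diagonalToHat k V m) γ
    (by
      intro x y
      rw [hγ, hγ, add_mul, mul_add, mul_add, hgg, Finset.mul_sum, Finset.mul_sum, Finset.sum_mul,
        Finset.sum_eq_zero, Finset.sum_eq_zero, Finset.sum_eq_zero]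
      · simp
      · intro l _
        exact hgv _ _ _
      · intro l _
        rw [mul_assoc, hvg, mul_zero]
      · intro l _
        rw [Finset.sum_mul]
        refine Finset.sum_eq_zero fun l' _ => ?_
        rw [← hatDownMk_mul_hatLayerMk l, ← mul_assoc, mul_assoc (hatLayerMk k V m _ _),
          hatDownMk_mul_hatDownMk, mul_zero, zero_mul])
    (by
      intro r x
      rw [hγ, hγ, mul_add, Finset.mul_sum, cornerEntry_smul, hgl]
      congr 1
      · refine Finset.sum_congr rfl fun l _ => ?_
        rw [← mul_assoc, diagonalToHat_mul_hatLayerMk, superdiagonal_smul]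
      · rw [← hgl1, ← mul_assoc, ← mul_assoc, ← hatLayerMk_mul, diagonalToHat_mul_hatLayerMk])
    (by
      intro r x
      rw [hγ, hγ, add_mul, Finset.sum_mul, cornerEntry_op_smul, hgr]
      congr 1
      · refine Finset.sum_congr rfl fun l _ => ?_
        rw [← hatDownMk_mul_hatLayerMk, ← hatDownMk_mul_hatLayerMk, mul_assoc,
          hatLayerMk_mul_diagonalToHat, superdiagonal_op_smul]
      · rw [← hgr1, mul_assoc, mul_assoc, ← hatLayerMk_mul, hatLayerMk_mul_diagonalToHat])
  refine ⟨G, fun l x => ?_, fun l x => ?_, fun a => ?_⟩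
  · exact (TrivSqZeroExt.lift_apply_inl _ _ _ _ _ _).trans (diagonalToHat_single l x)
  · refine (TrivSqZeroExt.lift_apply_inr _ _ _ _ _ _).trans ((hγ _).trans ?_)
    change ∑ l', hatLayerMk k V m l'.castSucc ((Pi.single l x : Fin m → PathAlgebra k V) l') *
      hatDownMk k V l' + g 0 = _
    rw [map_zero, add_zero, Finset.sum_eq_single l, Pi.single_eq_same]
    · intro l' _ h
      rw [Pi.single_eq_of_ne h, map_zero, zero_mul]
    · simp
  · refine (TrivSqZeroExt.lift_apply_inr _ _ _ _ _ _).trans ((hγ _).trans ?_)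
    change ∑ l', hatLayerMk k V m l'.castSucc 0 * hatDownMk k V l' + g (extArrow k a) = _
    have h : ∀ l' : Fin m, hatLayerMk k V m l'.castSucc (0 : PathAlgebra k V) *
        hatDownMk k V l' = 0 := fun l' => by rw [LinearMap.map_zero, zero_mul]
    rw [← hga, Finset.sum_eq_zero fun l' _ => h l', zero_add]

variable (k V m) in
/-- The homomorphism from the trivial extension algebra to the quotient. -/
noncomputable def trivialExtensionToHat :
    TrivialExtensionAlgebra.{u, max v w} k (PathAlgebra k V) 1 m →ₐ[k] HatQuotient k V m :=
  exists_trivialExtension_hom.choose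

/-- Two algebra homomorphisms agreeing on vertices and arrows are equal. This identity forces the
kernel of `hatMap` into `I`. -/
theorem trivialExtensionToHat_hatMap (x : PathAlgebra k (HatVertex V m)) :
    trivialExtensionToHat k V m (hatMap k V m x) = hatMk k V m x := by
  obtain ⟨hdiag, hsup, hcorner⟩ := (exists_trivialExtension_hom (k := k) (V := V) (m := m)).choose_spec
  have : (trivialExtensionToHat k V m).comp (hatMap k V m) = hatMk k V m := by
    refine algHom_ext (fun y => ?_) fun {y z} a => ?_
    · rw [AlgHom.comp_apply, hatMap_idem]
      refine (hdiag _ _).trans ?_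
      rw [hatLayerMk_apply, layerMap_idem]
    · rw [AlgHom.comp_apply, hatMap_arrow]
      change HatArrow V m y z at a
      cases a with
      | copy a l =>
        refine (hdiag _ _).trans ?_
        rw [hatLayerMk_apply, layerMap_arrow]
        rfl
      | down i l => exact (hsup _ _).trans (hatLayerMk_idem_mul_hatDownMk i l)
      | star a => exact hcorner _
  exact AlgHom.congr_fun this x

theorem mem_hatIdeal_iff {x : PathAlgebra k (HatVertex V m)} :
    x ∈ hatIdeal k V m ↔ hatMap k V m x = 0 := by
  refine ⟨hatMap_eq_zero_of_mem, fun h => ?_⟩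
  rw [← hatMk_eq_zero_iff, ← trivialExtensionToHat_hatMap, h, map_zero]

/-- The range contains the diagonal copies of `A`, and the superdiagonal and corner bimodules are
generated over them by the images of the arrows `vᵢˡ` and `a*`. -/
theorem hatMap_surjective : Function.Surjective (hatMap k V m) := by
  rw [← AlgHom.range_eq_top, eq_top_iff]
  rintro z -
  have hd : ∀ l x, diag k (PathAlgebra k V) 1 l x ∈ (hatMap k V m).range := fun l x =>
    ⟨_, hatMap_layerMap l x⟩
  have hs : ∀ l x, sup k (PathAlgebra k V) 1 l x ∈ (hatMap k V m).range := by
    intro l x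
    rw [← mul_one x, ← diag_mul_sup, one_def, map_sum]
    exact mul_mem (hd _ _) (sum_mem fun i _ => ⟨_, hatMap_hatDown i l⟩)
  have hc : ∀ x, corner k (PathAlgebra k V) 1 m x ∈ (hatMap k V m).range := by
    -- Membership in the range is the vanishing of a linear map, so it can be tested on the elements
    -- `b a* p`.
    have : (Subalgebra.toSubmodule (hatMap k V m).range).mkQ ∘ₗ
        corner k (PathAlgebra k V) 1 m = 0 := by
      refine extDual_linearMap_ext fun b p a => ?_
      rw [LinearMap.comp_apply, LinearMap.zero_apply, Submodule.mkQ_apply,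
        Submodule.Quotient.mk_eq_zero, Subalgebra.mem_toSubmodule, ← diag_last_mul_corner, ← corner_mul_diag_zero]
      exact mul_mem (hd _ _) (mul_mem ⟨_, hatMap_hatStar a.2.2⟩ (hd _ _))
    intro x
    have := LinearMap.congr_fun this x
    rwa [LinearMap.comp_apply, LinearMap.zero_apply, Submodule.mkQ_apply,
      Submodule.Quotient.mk_eq_zero] at this
  rw [← TrivSqZeroExt.inl_fst_add_inr_snd_eq z, ← sum_diag, ← sum_sup_add_corner]
  exact add_mem (sum_mem fun l _ => hd _ _) (add_mem (sum_mem fun l _ => hs _ _) (hc _))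

variable (k V m) in
/-- The trivial extension algebra is presented by the quiver with relations. -/
noncomputable def hatEquiv :
    HatQuotient k V m ≃ₐ[k] TrivialExtensionAlgebra.{u, max v w} k (PathAlgebra k V) 1 m :=
  AlgEquiv.ofBijective
    (RingCon.liftₐ _ (hatMap k V m) fun x y h => by
      have := hatMap_eq_zero_of_mem ((TwoSidedIdeal.rel_iff _ x y).mp h)
      rwa [map_sub, sub_eq_zero] at this)
    ⟨by
      rw [injective_iff_map_eq_zero]
      intro x hx
      obtain ⟨x, rfl⟩ := hatMk_surjective x
      exact hatMk_eq_zero_iff.mpr (mem_hatIdeal_iff.mpr hx),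
    fun z => by
      obtain ⟨x, rfl⟩ := hatMap_surjective z
      exact ⟨hatMk k V m x, rfl⟩⟩

omit [Finite (AllPaths V)] in
-- Lengths add under multiplication, so combinations of paths of length at least two form a
-- two-sided ideal, and only the generating relations need to be inspected.
theorem mem_lengthGE_of_mem_hatIdeal {x : PathAlgebra k (HatVertex V m)}
    (hx : x ∈ hatIdeal k V m) : x ∈ lengthGE k (HatVertex V m) 2 := by
  let J : TwoSidedIdeal (PathAlgebra k (HatVertex V m)) :=
    .mk' (lengthGE k (HatVertex V m) 2) (Submodule.zero_mem _) (Submodule.add_mem _)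
      (Submodule.neg_mem _)
      (fun {x y} hy => by
        have := mul_mem_lengthGE (r := 0) (s := 2) (mem_lengthGE_zero x) hy
        rwa [zero_add] at this)
      (fun {x y} hx => mul_mem_lengthGE (r := 2) (s := 0) hx (mem_lengthGE_zero y))
  have hJ : ∀ y, y ∈ J ↔ y ∈ lengthGE k (HatVertex V m) 2 := fun y =>
    TwoSidedIdeal.mem_mk' _ _ _ _ _ _ _
  refine (hJ x).mp (TwoSidedIdeal.span_le.mpr (fun y hy => (hJ y).mpr ?_) hx)
  have h2 : ∀ {x y x' y' : HatVertex V m} (a : x ⟶ y) (b : x' ⟶ y'),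
      arrow k a * arrow k b ∈ lengthGE k (HatVertex V m) 2 := fun a b =>
    mul_mem_lengthGE (r := 1) (s := 1) (arrow_mem_lengthGE a) (arrow_mem_lengthGE b)
  cases hy with
  | comm a l => exact Submodule.sub_mem _ (h2 _ _) (h2 _ _)
  | preprojective i =>
    exact Submodule.sub_mem _ (sum_mem fun j _ => sum_mem fun a _ => h2 _ _)
      (sum_mem fun j _ => sum_mem fun a _ => h2 _ _)
  | down_down i l l' h => exact h2 _ _
  | star_down a l h => exact h2 _ _
  | down_star a l h => exact h2 _ _
  | star_path_star hm a p c =>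
    exact mul_mem_lengthGE (r := 1) (s := 1)
      (mul_mem_lengthGE (r := 1) (s := 0) (arrow_mem_lengthGE _) (mem_lengthGE_zero _))
      (arrow_mem_lengthGE _)

variable (k V m) in
theorem isAdmissible_hatIdeal : IsAdmissible (hatIdeal k V m) := by
  obtain ⟨N, hN⟩ := exists_length_lt (V := V)
  -- A path with nonzero image consists of at most two paths of `Q`, each shorter than `N`, and one
  -- further arrow, so its length is less than `2 * N + 2`. The summand `2` also keeps the exponent
  -- at least two when `N = 0`.
  refine ⟨fun x => mem_lengthGE_of_mem_hatIdeal, 2 * N + 2, by omega, fun x hx => ?_⟩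
  rw [mem_hatIdeal_iff]
  induction hx using Submodule.span_induction with
  | zero => exact map_zero _
  | add x y _ _ hx hy => rw [map_add, hx, hy, add_zero]
  | smul c x _ hx => rw [map_smul, hx, smul_zero]
  | mem x hx =>
    obtain ⟨y, z, p, hp, rfl⟩ := hx
    rcases hatMap_ofPath (k := k) p with h | ⟨q, hq⟩ | ⟨-, i, j, q, q', hq⟩
    · exact h
    · have := hN _ _ q
      omega
    · have := hN _ _ q
      have := hN _ _ q'
      omega

end Isomorphism

theorem proposition9p3 {k : Type u} [Field k] {V : Type v} [Quiver.{w} V] [Fintype V]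
    [∀ i j : V, Fintype (i ⟶ j)]
    (acyclic : ∀ (i : V) (p : Quiver.Path i i), p.length = 0) (m : ℕ) :
    PathAlgebra.IsAdmissible (hatIdeal k V m) ∧
      Nonempty ((hatIdeal k V m).ringCon.Quotient ≃ₐ[k]
        TrivialExtensionAlgebra.{u, max v w} k (PathAlgebra k V) 1 m) := by
  have := AllPaths.finite_of_acyclic acyclic
  exact ⟨isAdmissible_hatIdeal k V m, ⟨hatEquiv k V m⟩⟩
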